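/- Let $m\ge 1$, $q\ge 0$ be integers, let $\mathcal M$ be the algebra of complex $m\times m$ matrices, and let $X_1,\dots,X_q\in\mathcal M$ be Hermitian. For $n\ge1$ let $$X_i^{(n)}=\frac1n\sum_{k=1}^n \mathbf 1\otimes\dots\otimes \mathbf 1\otimes X_i\otimes \mathbf 1\otimes\dots\otimes \mathbf 1\in\mathcal M^{\otimes n}\qquad (X_i\text{ in the }k\text{-th factor}).$$ Let $F:\mathbb R\to\mathbb R$ be continuous, and let $Q$ be a symmetric polynomial in $q$ noncommuting variables, i.e. a finite sum $Q=\sum_w c_w w$ over words $w$ in the letters $x_1,\dots,x_q$, with coefficients $c_w\in\mathbb C$, that equals its formal adjoint: $c_{w^{\mathrm{rev}}}=\overline{c_w}$ for every word $w$ with reversal $w^{\mathrm{rev}}$. (Thus $Q$ takes Hermitian values at Hermitian matrices and real values at points of $\mathbb R^q$; e.g. $Q$ may be any polynomial in commuting variables with real coefficients, its monomials being symmetrized in any such way.) Let $$C(s_1,\dots,s_q)=\ln\operatorname{Tr} e^{s_1X_1+\dots+s_qX_q},\qquad I(u)=\sup_{s\in\mathbb R^q}\big[\langle s,u\rangle-C(s)\big]\in(-\infty,+\infty].$$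 Then $\frac1n\ln\operatorname{Tr}\exp\big(n\,F(Q(X_1^{(n)},\dots,X_q^{(n)}))\big)$, where $F$ is applied through the functional calculus of Hermitian matrices, converges as $n\to\infty$ to a real number, and $$\lim_{n\to\infty}\frac1n\ln\operatorname{Tr}\exp\big(n\,F(Q(X_1^{(n)},\dots,X_q^{(n)}))\big)=\sup_{u\in\prod_{i=1}^q\operatorname{co}(\sigma(X_i))}\big[F(Q(u))-I(u)\big],$$ where $\operatorname{co}(\sigma(X_i))$ is the convex hull of the spectrum of $X_i$. -/

import Mathlib

open Filter Topology

noncomputable section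

namespace MeanField

/-- The elementary tensor `A 0 ⊗ A 1 ⊗ ⋯ ⊗ A (n - 1)` of complex `m × m` matrices, as a matrix
acting on `(ℂ^m)^{⊗ n}`, whose standard basis is indexed by the words `Fin n → Fin m`. -/
def tensor {m n : ℕ} (A : Fin n → Matrix (Fin m) (Fin m) ℂ) :
    Matrix (Fin n → Fin m) (Fin n → Fin m) ℂ :=
  Matrix.of fun σ τ => ∏ k, A k (σ k) (τ k)

/-- `1 ⊗ ⋯ ⊗ 1 ⊗ X ⊗ 1 ⊗ ⋯ ⊗ 1`, with `X` in the `k`-th of `n` factors. -/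
def site {m : ℕ} (n : ℕ) (X : Matrix (Fin m) (Fin m) ℂ) (k : Fin n) :
    Matrix (Fin n → Fin m) (Fin n → Fin m) ℂ :=
  tensor (Function.update (fun _ => 1) k X)

/-- The mean-field average `X^{(n)} = (1/n) ∑ k, X_k`. -/
def average {m : ℕ} (n : ℕ) (X : Matrix (Fin m) (Fin m) ℂ) :
    Matrix (Fin n → Fin m) (Fin n → Fin m) ℂ :=
  (1 / (n : ℂ)) • ∑ k : Fin n, site n X k

/-- Polynomials with complex coefficients in `q` noncommuting variables: finite linear
combinations of words in the letters `0, …, q - 1`. -/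
abbrev NCPoly (q : ℕ) : Type := MonoidAlgebra ℂ (FreeMonoid (Fin q))

/-- A polynomial in noncommuting variables is symmetric if it is its own formal adjoint:
the coefficient of each reversed word is the complex conjugate of the coefficient of the word.
(On `FreeMonoid`, `star` is the reversal of words.) -/
def NCPoly.IsSymmetric {q : ℕ} (Q : NCPoly q) : Prop :=
  ∀ w : FreeMonoid (Fin q), Q.coeff (star w) = star (Q.coeff w)

/-- Substitution of the elements `a 0, …, a (q - 1)` of a complex algebra for the variables. -/
def NCPoly.eval {q : ℕ} {A : Type*} [Ring A] [Algebra ℂ A] (Q : NCPoly q) (a : Fin q → A) : A :=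
  MonoidAlgebra.lift ℂ A (FreeMonoid (Fin q)) (FreeMonoid.lift a) Q

/-- The value of `Q` at a point of `ℝ^q`. For symmetric `Q` the value at real arguments is a real
number, so that taking the real part only changes the type. -/
def NCPoly.realEval {q : ℕ} (Q : NCPoly q) (u : Fin q → ℝ) : ℝ :=
  (Q.eval (fun i => (u i : ℂ))).re

/-- `ln Tr e^A`. For Hermitian `A` the trace is a real number, so that taking the real part only
changes the type. -/
def logTraceExp {ι : Type*} [Fintype ι] [DecidableEq ι] (A : Matrix ι ι ℂ) : ℝ :=
  Real.log (Matrix.trace (NormedSpace.exp A)).re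

/-- The cumulant generating function `C(s) = ln Tr exp (s_1 X_1 + ⋯ + s_q X_q)`. -/
def cumulant {m q : ℕ} (X : Fin q → Matrix (Fin m) (Fin m) ℂ) (s : Fin q → ℝ) : ℝ :=
  logTraceExp (∑ i, s i • X i)

/-- The rate function, the Legendre transform `I(u) = sup_s [⟨s, u⟩ - C(s)]`, which may take the
value `+∞`. -/
def rate {m q : ℕ} (X : Fin q → Matrix (Fin m) (Fin m) ℂ) (u : Fin q → ℝ) : EReal :=
  ⨆ s : Fin q → ℝ, ((∑ i, s i * u i - cumulant X s : ℝ) : EReal)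

end MeanField

end

/-! The averages `X_i^{(n)}` are bounded and their commutators are `O(1/n)`, so asymptotically they
behave like commuting variables. This is made precise by an approximate joint diagonalization
(`exists_represents`): finite families `B_u` with `∑ B_u* B_u = 1` and points `x_u` of a cube in
`ℝ^q` such that the column with entries `B_u X_i - x_{u,i} B_u` is small in operator norm. Call a
sequence `a` represented by a function `g` if `B_u a` is close to `g(x_u) B_u` in the same sense.
Representation is preserved by sums, products and continuous functional calculus, so `A =
F(Q(X^{(n)}))` is represented by `f = F ∘ Q`. As `u ↦ B_u a` has the norm of `a`, bounds on `g` over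
the cube become operator bounds on `a`, up to a vanishing error (`eventually_re_trace_ge`).

Lower bound: apply the Peierls–Bogoliubov inequality to the product state proportional to `exp(n ∑
s_i X_i^{(n)})`. There the averages have means `u_s`, the one-site tilted expectations, and
variances `O(1/n)`. A quadratic minorant of `f` at `u_s` shows that the mean of `A` is at least
`f(u_s) - o(1)`, which gives `f(u_s) + C(s) - ⟨s, u_s⟩`.

Upper bound: suppose each `x` in the cube has an `s` with `f(x) + C(s) - ⟨s, x⟩ ≤ V`. Finitely many
windows `p(A) θ(Y)² p(A)`, with `Y = ∑ s_i X_i^{(n)}`, have a sum represented by a function bounded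
below by a positive constant, so they control `Tr e^{nA}`. In one window `e^{nA}` is bounded through
`p(A)`, and `Tr θ(Y)²` by a Chernoff estimate.

The two bounds meet by duality: a point `u` with `I(u) ≤ r` is approximated by tilted points at
which `⟨s, u_s⟩ - C(s) ≤ r` (`exists_tiltedPoint_near`), found by minimizing `C(s) - ⟨s, u⟩` with a
small quadratic penalty. -/

noncomputable section

namespace MeanField

section Representation

open scoped Matrix.Norms.L2Operator MatrixOrder

/-! ### Columns of matrices -/

section Column

variable {U V ι : Type} [Fintype U] [Fintype V] [Fintype ι] [DecidableEq ι]

/-- The matrices `c u` stacked on top of each other. -/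
def blockCol (c : U → Matrix ι ι ℂ) : Matrix (U × ι) ι ℂ :=
  Matrix.of fun p j => c p.1 p.2 j

/-- The operator norm of a column of matrices. -/
def colNorm (c : U → Matrix ι ι ℂ) : ℝ := ‖blockCol c‖

lemma colNorm_nonneg (c : U → Matrix ι ι ℂ) : 0 ≤ colNorm c := norm_nonneg _

lemma colNorm_add_le (c d : U → Matrix ι ι ℂ) :
    colNorm (fun u => c u + d u) ≤ colNorm c + colNorm d :=
  norm_add_le (blockCol c) (blockCol d)

lemma colNorm_mul_right_le (c : U → Matrix ι ι ℂ) (b : Matrix ι ι ℂ) :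
    colNorm (fun u => c u * b) ≤ colNorm c * ‖b‖ := by
  have : blockCol (fun u => c u * b) = blockCol c * b := by
    ext p j
    simp [blockCol, Matrix.mul_apply]
  rw [colNorm, this]
  exact Matrix.l2_opNorm_mul _ _

lemma colNorm_smul_le (c : U → Matrix ι ι ℂ) (g : U → ℂ) {M : ℝ} (hM : 0 ≤ M)
    (hg : ∀ u, ‖g u‖ ≤ M) : colNorm (fun u => g u • c u) ≤ M * colNorm c := by
  classical
  have : blockCol (fun u => g u • c u) =
      Matrix.diagonal (fun p : U × ι => g p.1) * blockCol c := by
    ext p j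
    simp [blockCol, Matrix.diagonal_mul]
  rw [colNorm, this]
  refine (Matrix.l2_opNorm_mul _ _).trans ?_
  rw [Matrix.l2_opNorm_diagonal]
  exact mul_le_mul_of_nonneg_right ((pi_norm_le_iff_of_nonneg hM).2 fun p => hg p.1)
    (norm_nonneg _)

/-- The C*-identity for the stacked matrix. It reduces comparisons of columns to operator
inequalities between sums `∑ c* c`. -/
lemma colNorm_sq (c : U → Matrix ι ι ℂ) : colNorm c ^ 2 = ‖∑ u, star (c u) * c u‖ := by
  have : (blockCol c).conjTranspose * blockCol c = ∑ u, star (c u) * c u := by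
    ext i j
    simp [blockCol, Matrix.mul_apply, Fintype.sum_prod_type, Matrix.sum_apply]
  rw [← this, Matrix.l2_opNorm_conjTranspose_mul_self, sq, colNorm]

lemma colNorm_le_sum (c : U → Matrix ι ι ℂ) : colNorm c ≤ ∑ u, ‖c u‖ := by
  have h0 : 0 ≤ ∑ u, ‖c u‖ := Finset.sum_nonneg fun u _ => norm_nonneg _
  refine le_of_sq_le_sq ?_ h0
  rw [colNorm_sq]
  calc ‖∑ u, star (c u) * c u‖ ≤ ∑ u, ‖star (c u) * c u‖ := norm_sum_le _ _
    _ = ∑ u, ‖c u‖ * ‖c u‖ := by simp [CStarRing.norm_star_mul_self]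
    _ ≤ ∑ u, ‖c u‖ * ∑ v, ‖c v‖ := Finset.sum_le_sum fun u _ =>
        mul_le_mul_of_nonneg_left
          (Finset.single_le_sum (f := fun v => ‖c v‖) (fun v _ => norm_nonneg _)
            (Finset.mem_univ u)) (norm_nonneg _)
    _ = (∑ u, ‖c u‖) ^ 2 := by rw [← Finset.sum_mul, sq]

/-- A column of an isometry followed by a column has the norm of the latter. -/
lemma colNorm_prod_eq {B : U → Matrix ι ι ℂ} (hB : ∑ u, star (B u) * B u = 1)
    (c : V → Matrix ι ι ℂ) : colNorm (fun p : V × U => B p.2 * c p.1) = colNorm c := by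
  have h : colNorm (fun p : V × U => B p.2 * c p.1) ^ 2 = colNorm c ^ 2 := by
    rw [colNorm_sq, colNorm_sq, Fintype.sum_prod_type]
    congr 1
    refine Finset.sum_congr rfl fun v _ => ?_
    calc ∑ u, star (B u * c v) * (B u * c v)
        = star (c v) * (∑ u, star (B u) * B u) * c v := by
          simp [Finset.mul_sum, Finset.sum_mul, mul_assoc]
      _ = _ := by rw [hB, mul_one]
  exact (pow_left_inj₀ (colNorm_nonneg _) (colNorm_nonneg _) two_ne_zero).1 h

lemma colNorm_isometry_mul {B : U → Matrix ι ι ℂ} (hB : ∑ u, star (B u) * B u = 1)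
    (a : Matrix ι ι ℂ) : colNorm (fun u => B u * a) = ‖a‖ := by
  have h : colNorm (fun u => B u * a) ^ 2 = ‖a‖ ^ 2 := by
    rw [colNorm_sq]
    calc ‖∑ u, star (B u * a) * (B u * a)‖
        = ‖star a * (∑ u, star (B u) * B u) * a‖ := by
          simp [Finset.mul_sum, Finset.sum_mul, mul_assoc]
      _ = _ := by rw [hB, mul_one, CStarRing.norm_star_mul_self, sq]
  exact (pow_left_inj₀ (colNorm_nonneg _) (norm_nonneg _) two_ne_zero).1 h

/-- The norm of a column preceded by the column of a partition of unity does not increase. -/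
lemma colNorm_prod_le {P : V → Matrix ι ι ℂ} (hP : ∑ v, star (P v) * P v = 1)
    (c : U → Matrix ι ι ℂ) : colNorm (fun p : V × U => c p.2 * P p.1) ≤ colNorm c := by
  refine le_of_sq_le_sq ?_ (colNorm_nonneg _)
  rw [colNorm_sq, colNorm_sq, Fintype.sum_prod_type]
  set T := ∑ u, star (c u) * c u with hT
  have hT0 : 0 ≤ T := Finset.sum_nonneg fun u _ => star_mul_self_nonneg _
  have e : ∀ v, ∑ u, star (c u * P v) * (c u * P v) = star (P v) * T * P v := fun v => by
    simp [hT, Finset.mul_sum, Finset.sum_mul, mul_assoc]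
  simp only [e]
  have h0 : 0 ≤ ∑ v, star (P v) * T * P v :=
    Finset.sum_nonneg fun v _ => star_left_conjugate_nonneg hT0 _
  rw [CStarAlgebra.norm_le_iff_le_algebraMap _ (norm_nonneg _) h0]
  calc ∑ v, star (P v) * T * P v
      ≤ ∑ v, star (P v) * algebraMap ℝ _ ‖T‖ * P v := Finset.sum_le_sum fun v _ =>
        star_left_conjugate_le_conjugate (IsSelfAdjoint.of_nonneg hT0).le_algebraMap_norm_self _
    _ = ∑ v, ‖T‖ • (star (P v) * P v) := by
        simp [Algebra.algebraMap_eq_smul_one]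
    _ = algebraMap ℝ _ ‖T‖ := by
        rw [← Finset.smul_sum, hP, Algebra.algebraMap_eq_smul_one]

end Column

/-! ### Functional calculus estimates -/

section Calculus

variable {ι : Type} [Fintype ι] [DecidableEq ι] [Nonempty ι]

lemma abs_le_of_mem_spectrum {a : Matrix ι ι ℂ} {R : ℝ} (h : ‖a‖ ≤ R) {t : ℝ}
    (ht : t ∈ spectrum ℝ a) : |t| ≤ R :=
  (spectrum.norm_le_norm_of_mem ht).trans h

/-- The spectrum lies in `[-R, R]`, so uniform Weierstrass approximation there becomes norm
approximation, with an error independent of the matrix size. -/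
lemma norm_cfc_sub_aeval_le {a : Matrix ι ι ℂ} (ha : IsSelfAdjoint a) {R ε : ℝ} (h : ‖a‖ ≤ R)
    {φ : ℝ → ℝ} (hφ : Continuous φ) {p : Polynomial ℝ} (hε : 0 ≤ ε)
    (hp : ∀ t ∈ Set.Icc (-R) R, |p.eval t - φ t| ≤ ε) :
    ‖cfc φ a - Polynomial.aeval a p‖ ≤ ε := by
  rw [← cfc_polynomial p a, ← cfc_sub φ (fun t => p.eval t) a hφ.continuousOn
    p.continuous.continuousOn]
  refine norm_cfc_le hε fun t ht => ?_
  rw [Real.norm_eq_abs, abs_sub_comm]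
  exact hp t (abs_le.1 (abs_le_of_mem_spectrum h ht))

end Calculus

/-! ### Functions of asymptotically commuting matrices -/

section Commutator

variable {J : Type} {l : Filter J} {ι : J → Type} [∀ j, Fintype (ι j)] [∀ j, DecidableEq (ι j)]

/-- Induction on the degree by the Leibniz rule for commutators. The uniform norm bound is carried
along because the Leibniz rule multiplies the old commutators by these polynomials. -/
lemma tendsto_norm_commutator_aeval {a b : ∀ j, Matrix (ι j) (ι j) ℂ} {R : ℝ}
    (ha : ∀ j, ‖a j‖ ≤ R) (hab : Tendsto (fun j => ‖a j * b j - b j * a j‖) l (𝓝 0))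
    (p : Polynomial ℝ) :
    (∃ M, ∀ j, ‖Polynomial.aeval (a j) p‖ ≤ M) ∧
    Tendsto (fun j => ‖Polynomial.aeval (a j) p * b j - b j * Polynomial.aeval (a j) p‖) l
      (𝓝 0) := by
  induction p using Polynomial.induction_on' with
  | add p q hp hq =>
    obtain ⟨⟨M, hM⟩, h1⟩ := hp
    obtain ⟨⟨N, hN⟩, h2⟩ := hq
    refine ⟨⟨M + N, fun j => ?_⟩, ?_⟩
    · rw [map_add]
      exact (norm_add_le _ _).trans (add_le_add (hM j) (hN j))
    · refine squeeze_zero (fun j => norm_nonneg _) (fun j => ?_) (by simpa using h1.add h2)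
      refine le_trans (le_of_eq ?_) (norm_add_le _ _)
      rw [map_add]
      congr 1
      noncomm_ring
  | monomial n c =>
    induction n generalizing c with
    | zero =>
      refine ⟨⟨|c| * 1, fun j => ?_⟩, ?_⟩
      · rw [Polynomial.monomial_zero_left, Polynomial.aeval_C, Algebra.algebraMap_eq_smul_one,
          norm_smul, Real.norm_eq_abs]
        refine mul_le_mul_of_nonneg_left ?_ (abs_nonneg _)
        rcases isEmpty_or_nonempty (ι j) with h | h
        · rw [Subsingleton.elim (1 : Matrix (ι j) (ι j) ℂ) 0, norm_zero]
          exact zero_le_one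
        · exact (CStarRing.norm_one).le
      · refine tendsto_const_nhds.congr fun j => ?_
        rw [Polynomial.monomial_zero_left, Polynomial.aeval_C, Algebra.commutes, sub_self,
          norm_zero]
    | succ n ih =>
      obtain ⟨⟨M, hM⟩, h1⟩ := ih c
      have e : ∀ j, Polynomial.aeval (a j) (Polynomial.monomial (n + 1) c) =
          Polynomial.aeval (a j) (Polynomial.monomial n c) * a j := fun j => by
        rw [← Polynomial.monomial_mul_X, map_mul, Polynomial.aeval_X]
      refine ⟨⟨M * R, fun j => ?_⟩, ?_⟩
      · rw [e]
        exact (norm_mul_le _ _).trans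
          (mul_le_mul (hM j) (ha j) (norm_nonneg _) ((norm_nonneg _).trans (hM j)))
      · have h2 := (hab.const_mul M).add (h1.mul_const R)
        rw [mul_zero, zero_mul, add_zero] at h2
        refine squeeze_zero (fun j => norm_nonneg _) (fun j => ?_) h2
        rw [e]
        set P := Polynomial.aeval (a j) (Polynomial.monomial n c)
        have : P * a j * b j - b j * (P * a j) =
            P * (a j * b j - b j * a j) + (P * b j - b j * P) * a j := by
          rw [mul_sub, sub_mul, mul_assoc, mul_assoc, mul_assoc]
          abel
        rw [this]
        refine (norm_add_le _ _).trans (add_le_add ((norm_mul_le _ _).trans ?_)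
          ((norm_mul_le _ _).trans ?_))
        · exact mul_le_mul_of_nonneg_right (hM j) (norm_nonneg _)
        · exact mul_le_mul_of_nonneg_left (ha j) (norm_nonneg _)

/-- Continuous functions of asymptotically commuting matrices commute asymptotically. -/
lemma tendsto_norm_commutator_cfc [∀ j, Nonempty (ι j)] {a b : ∀ j, Matrix (ι j) (ι j) ℂ}
    {R S : ℝ} (hsa : ∀ j, IsSelfAdjoint (a j)) (ha : ∀ j, ‖a j‖ ≤ R) (hb : ∀ j, ‖b j‖ ≤ S)
    (hab : Tendsto (fun j => ‖a j * b j - b j * a j‖) l (𝓝 0)) {φ : ℝ → ℝ} (hφ : Continuous φ) :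
    Tendsto (fun j => ‖cfc φ (a j) * b j - b j * cfc φ (a j)‖) l (𝓝 0) := by
  rw [Metric.tendsto_nhds]
  intro ε hε
  have hS : 0 < |S| + 1 := by positivity
  -- Replacing the function by a polynomial costs two terms of size `δ (|S| + 1) = ε / 4`; the
  -- commutator of the polynomial takes the other `ε / 2`.
  set δ := ε / (4 * (|S| + 1)) with hδ
  have hδ0 : 0 < δ := by positivity
  obtain ⟨p, hp⟩ := exists_polynomial_near_of_continuousOn (-R) R φ hφ.continuousOn δ hδ0
  have h := (tendsto_norm_commutator_aeval ha hab p).2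
  rw [Metric.tendsto_nhds] at h
  filter_upwards [h (ε / 2) (by positivity)] with j hj
  rw [Real.dist_eq, sub_zero, abs_of_nonneg (norm_nonneg _)] at hj ⊢
  set P := Polynomial.aeval (a j) p
  set C := cfc φ (a j)
  have hd : ‖C - P‖ ≤ δ := norm_cfc_sub_aeval_le (hsa j) (ha j) hφ hδ0.le fun t ht => (hp t ht).le
  have hb' : ‖b j‖ ≤ |S| + 1 := (hb j).trans ((le_abs_self S).trans (by linarith))
  have e : C * b j - b j * C = (C - P) * b j + (P * b j - b j * P) - b j * (C - P) := by
    noncomm_ring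
  have h1 : ‖(C - P) * b j‖ ≤ δ * (|S| + 1) :=
    (norm_mul_le _ _).trans (mul_le_mul hd hb' (norm_nonneg _) hδ0.le)
  have h2 : ‖b j * (C - P)‖ ≤ δ * (|S| + 1) := by
    rw [mul_comm δ]
    exact (norm_mul_le _ _).trans (mul_le_mul hb' hd (norm_nonneg _) hS.le)
  have h3 : δ * (|S| + 1) = ε / 4 := by rw [hδ]; field_simp
  rw [e]
  have := norm_sub_le ((C - P) * b j + (P * b j - b j * P)) (b j * (C - P))
  have := norm_add_le ((C - P) * b j) (P * b j - b j * P)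
  linarith

end Commutator

/-! ### Asymptotic representations -/

/-- Finite resolutions of the identity `∑ u, (B u)* B u = 1`, each of whose members is assigned
a point of `K ⊆ ℝ^q`. -/
structure JointResolution {q : ℕ} (K : Set (Fin q → ℝ)) {J : Type} (ι : J → Type)
    [∀ j, Fintype (ι j)] [∀ j, DecidableEq (ι j)] where
  U : J → Type
  fin : ∀ j, Fintype (U j)
  pt : ∀ j, U j → Fin q → ℝ
  B : ∀ j, U j → Matrix (ι j) (ι j) ℂ
  mem : ∀ j u, pt j u ∈ K
  sum_eq : ∀ j, ∑ u, star (B j u) * B j u = 1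

attribute [instance] JointResolution.fin

namespace JointResolution

variable {q : ℕ} {K : Set (Fin q → ℝ)} {J : Type} {l : Filter J} {ι : J → Type}
  [∀ j, Fintype (ι j)] [∀ j, DecidableEq (ι j)] (D : JointResolution K ι)

/-- How far the resolution is from diagonalizing `a` with eigenvalues `g`. -/
def defect (g : (Fin q → ℝ) → ℂ) (j : J) (a : Matrix (ι j) (ι j) ℂ) : ℝ :=
  colNorm fun u => D.B j u * a - g (D.pt j u) • D.B j u

lemma defect_nonneg (g : (Fin q → ℝ) → ℂ) (j : J) (a : Matrix (ι j) (ι j) ℂ) :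
    0 ≤ D.defect g j a := colNorm_nonneg _

lemma colNorm_B_le (j : J) : colNorm (D.B j) ≤ 1 := by
  have h := colNorm_isometry_mul (D.sum_eq j) 1
  simp only [mul_one] at h
  rw [h]
  rcases isEmpty_or_nonempty (ι j) with h | h
  · rw [Subsingleton.elim (1 : Matrix (ι j) (ι j) ℂ) 0, norm_zero]
    exact zero_le_one
  · exact (CStarRing.norm_one).le

lemma defect_add_le (g h : (Fin q → ℝ) → ℂ) (j : J) (a b : Matrix (ι j) (ι j) ℂ) :
    D.defect (fun x => g x + h x) j (a + b) ≤ D.defect g j a + D.defect h j b := by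
  refine le_trans (le_of_eq ?_) (colNorm_add_le _ _)
  unfold defect
  congr 1
  funext u
  rw [mul_add, add_smul]
  abel

/-- From `B a b - g h B = (B a - g B) b + g (B b - h B)`. Matrices act on `B` from the right only,
so no commutation of `a` and `b` is used. -/
lemma defect_mul_le (g h : (Fin q → ℝ) → ℂ) (j : J) (a b : Matrix (ι j) (ι j) ℂ) {M : ℝ}
    (hM : 0 ≤ M) (hg : ∀ x ∈ K, ‖g x‖ ≤ M) :
    D.defect (fun x => g x * h x) j (a * b) ≤ D.defect g j a * ‖b‖ + M * D.defect h j b := by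
  have e : D.defect (fun x => g x * h x) j (a * b) =
      colNorm (fun u => (D.B j u * a - g (D.pt j u) • D.B j u) * b +
        g (D.pt j u) • (D.B j u * b - h (D.pt j u) • D.B j u)) := by
    unfold defect
    congr 1
    funext u
    rw [sub_mul, smul_sub, smul_smul, smul_mul_assoc, mul_assoc]
    abel
  rw [e]
  exact (colNorm_add_le _ _).trans (add_le_add (colNorm_mul_right_le _ _)
    (colNorm_smul_le _ _ hM fun u => hg _ (D.mem j u)))

lemma defect_le (g : (Fin q → ℝ) → ℂ) (j : J) (a : Matrix (ι j) (ι j) ℂ) {M : ℝ}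
    (hM : 0 ≤ M) (hg : ∀ x ∈ K, ‖g x‖ ≤ M) : D.defect g j a ≤ ‖a‖ + M := by
  have e : D.defect g j a = colNorm (fun u => D.B j u * a + (-g (D.pt j u)) • D.B j u) := by
    unfold defect
    congr 1
    funext u
    rw [neg_smul, sub_eq_add_neg]
  rw [e]
  refine (colNorm_add_le _ _).trans (add_le_add (colNorm_isometry_mul (D.sum_eq j) a).le ?_)
  refine (colNorm_smul_le _ _ hM fun u => ?_).trans (mul_le_of_le_one_right hM (D.colNorm_B_le j))
  rw [norm_neg]
  exact hg _ (D.mem j u)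

/-- The column `B_u a` has exactly the norm of `a` and is close to `g(x_u) B_u`. This is the only
passage from functions on `K` back to operators. -/
lemma norm_le_defect_add (g : (Fin q → ℝ) → ℂ) (j : J) (a : Matrix (ι j) (ι j) ℂ) {M : ℝ}
    (hM : 0 ≤ M) (hg : ∀ x ∈ K, ‖g x‖ ≤ M) : ‖a‖ ≤ D.defect g j a + M := by
  rw [← colNorm_isometry_mul (D.sum_eq j) a]
  have e : (fun u => D.B j u * a) = fun u =>
      (D.B j u * a - g (D.pt j u) • D.B j u) + g (D.pt j u) • D.B j u := by
    funext u
    rw [sub_add_cancel]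
  rw [e]
  exact (colNorm_add_le _ _).trans (add_le_add le_rfl
    ((colNorm_smul_le _ _ hM fun u => hg _ (D.mem j u)).trans
      (mul_le_of_le_one_right hM (D.colNorm_B_le j))))

/-- The bounded sequence `a` of matrices acts asymptotically as the bounded function `g` on `K`. -/
structure Represents (l : Filter J) (g : (Fin q → ℝ) → ℂ) (a : ∀ j, Matrix (ι j) (ι j) ℂ) :
    Prop where
  bdd_fun : ∃ M, 0 ≤ M ∧ ∀ x ∈ K, ‖g x‖ ≤ M
  bdd_op : ∃ M, 0 ≤ M ∧ ∀ j, ‖a j‖ ≤ M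
  tendsto : Tendsto (fun j => D.defect g j (a j)) l (𝓝 0)

variable {D}

lemma Represents.const (c : ℂ) : D.Represents l (fun _ => c) (fun _ => c • 1) where
  bdd_fun := ⟨‖c‖, norm_nonneg _, fun _ _ => le_rfl⟩
  bdd_op := by
    refine ⟨‖c‖, norm_nonneg _, fun j => ?_⟩
    rw [norm_smul]
    refine mul_le_of_le_one_right (norm_nonneg _) ?_
    rcases isEmpty_or_nonempty (ι j) with h | h
    · rw [Subsingleton.elim (1 : Matrix (ι j) (ι j) ℂ) 0, norm_zero]
      exact zero_le_one
    · exact (CStarRing.norm_one).le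
  tendsto := by
    refine tendsto_const_nhds.congr fun j => ?_
    have e : (fun u => D.B j u * (c • 1) - c • D.B j u) = fun _ => 0 := by
      funext u
      simp
    rw [defect, e]
    exact (norm_zero (E := Matrix (D.U j × ι j) (ι j) ℂ)).symm

lemma Represents.add {g h : (Fin q → ℝ) → ℂ} {a b : ∀ j, Matrix (ι j) (ι j) ℂ}
    (ha : D.Represents l g a) (hb : D.Represents l h b) :
    D.Represents l (fun x => g x + h x) (fun j => a j + b j) where
  bdd_fun := by
    obtain ⟨M, hM, h1⟩ := ha.bdd_fun
    obtain ⟨N, hN, h2⟩ := hb.bdd_fun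
    exact ⟨M + N, by positivity, fun x hx =>
      (norm_add_le _ _).trans (add_le_add (h1 x hx) (h2 x hx))⟩
  bdd_op := by
    obtain ⟨M, hM, h1⟩ := ha.bdd_op
    obtain ⟨N, hN, h2⟩ := hb.bdd_op
    exact ⟨M + N, by positivity, fun j => (norm_add_le _ _).trans (add_le_add (h1 j) (h2 j))⟩
  tendsto := squeeze_zero (fun j => D.defect_nonneg _ _ _) (fun j => D.defect_add_le _ _ _ _ _)
    (by simpa using ha.tendsto.add hb.tendsto)

lemma Represents.mul {g h : (Fin q → ℝ) → ℂ} {a b : ∀ j, Matrix (ι j) (ι j) ℂ}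
    (ha : D.Represents l g a) (hb : D.Represents l h b) :
    D.Represents l (fun x => g x * h x) (fun j => a j * b j) where
  bdd_fun := by
    obtain ⟨M, hM, h1⟩ := ha.bdd_fun
    obtain ⟨N, hN, h2⟩ := hb.bdd_fun
    exact ⟨M * N, by positivity, fun x hx =>
      (norm_mul_le _ _).trans (mul_le_mul (h1 x hx) (h2 x hx) (norm_nonneg _) hM)⟩
  bdd_op := by
    obtain ⟨M, hM, h1⟩ := ha.bdd_op
    obtain ⟨N, hN, h2⟩ := hb.bdd_op
    exact ⟨M * N, by positivity, fun j =>
      (norm_mul_le _ _).trans (mul_le_mul (h1 j) (h2 j) (norm_nonneg _) hM)⟩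
  tendsto := by
    obtain ⟨M, hM, h1⟩ := ha.bdd_fun
    obtain ⟨N, hN, h2⟩ := hb.bdd_op
    refine squeeze_zero (fun j => D.defect_nonneg _ _ _)
      (fun j => (D.defect_mul_le _ _ _ _ _ hM h1).trans (add_le_add
        (mul_le_mul_of_nonneg_left (h2 j) (D.defect_nonneg _ _ _)) le_rfl))
      (by simpa using (ha.tendsto.mul_const N).add (hb.tendsto.const_mul M))

lemma Represents.smul (c : ℂ) {g : (Fin q → ℝ) → ℂ} {a : ∀ j, Matrix (ι j) (ι j) ℂ}
    (ha : D.Represents l g a) : D.Represents l (fun x => c * g x) (fun j => c • a j) := by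
  simpa using (Represents.const (D := D) (l := l) c).mul ha

lemma Represents.sub {g h : (Fin q → ℝ) → ℂ} {a b : ∀ j, Matrix (ι j) (ι j) ℂ}
    (ha : D.Represents l g a) (hb : D.Represents l h b) :
    D.Represents l (fun x => g x - h x) (fun j => a j - b j) := by
  simpa [sub_eq_add_neg] using ha.add (hb.smul (-1))

lemma Represents.sum {κ : Type} (s : Finset κ) {g : κ → (Fin q → ℝ) → ℂ}
    {a : κ → ∀ j, Matrix (ι j) (ι j) ℂ} (ha : ∀ k ∈ s, D.Represents l (g k) (a k)) :
    D.Represents l (fun x => ∑ k ∈ s, g k x) (fun j => ∑ k ∈ s, a k j) := by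
  classical
  induction s using Finset.induction_on with
  | empty => simpa using Represents.const (D := D) (l := l) 0
  | insert k s hk ih =>
    simp only [Finset.sum_insert hk]
    exact (ha k (Finset.mem_insert_self k s)).add
      (ih fun i hi => ha i (Finset.mem_insert_of_mem hi))

lemma Represents.aeval {g : (Fin q → ℝ) → ℝ} {a : ∀ j, Matrix (ι j) (ι j) ℂ}
    (ha : D.Represents l (fun x => (g x : ℂ)) a) (p : Polynomial ℝ) :
    D.Represents l (fun x => ((p.eval (g x) : ℝ) : ℂ)) (fun j => Polynomial.aeval (a j) p) := by
  induction p using Polynomial.induction_on' with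
  | add p q hp hq => simpa using hp.add hq
  | monomial n c =>
    induction n generalizing c with
    | zero =>
      have h := Represents.const (D := D) (l := l) (c : ℂ)
      simpa [Algebra.algebraMap_eq_smul_one, Complex.coe_smul] using h
    | succ n ih =>
      have h := (ih c).mul ha
      simp only [← Polynomial.monomial_mul_X, Polynomial.eval_mul, Polynomial.eval_X, map_mul,
        Polynomial.aeval_X, Complex.ofReal_mul]
      exact h

lemma Represents.cfc [∀ j, Nonempty (ι j)] {g : (Fin q → ℝ) → ℝ}
    {a : ∀ j, Matrix (ι j) (ι j) ℂ}
    (ha : D.Represents l (fun x => (g x : ℂ)) a) (hsa : ∀ j, IsSelfAdjoint (a j)) {F : ℝ → ℝ}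
    (hF : Continuous F) :
    D.Represents l (fun x => (F (g x) : ℂ)) (fun j => cfc F (a j)) := by
  obtain ⟨M₁, hM₁, hg⟩ := ha.bdd_fun
  obtain ⟨M₂, hM₂, hop⟩ := ha.bdd_op
  -- One interval contains both the values of `g` and the spectra of the `a j`, so one polynomial
  -- approximates `F` for both.
  set M := max M₁ M₂
  have hg' : ∀ x ∈ K, g x ∈ Set.Icc (-M) M := fun x hx => by
    have := hg x hx
    rw [Complex.norm_real, Real.norm_eq_abs] at this
    exact abs_le.1 (this.trans (le_max_left _ _))
  have hop' : ∀ j, ‖a j‖ ≤ M := fun j => (hop j).trans (le_max_right _ _)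
  obtain ⟨S, hS⟩ := isCompact_Icc.exists_bound_of_continuousOn (hF.continuousOn (s := Set.Icc (-M) M))
  refine ⟨⟨|S|, abs_nonneg S, fun x hx => ?_⟩, ⟨|S|, abs_nonneg S, fun j => ?_⟩, ?_⟩
  · rw [Complex.norm_real]
    exact (hS _ (hg' x hx)).trans (le_abs_self S)
  · exact norm_cfc_le (abs_nonneg S) fun t ht =>
      (hS t (abs_le.1 (abs_le_of_mem_spectrum (hop' j) ht))).trans (le_abs_self S)
  · rw [Metric.tendsto_nhds]
    intro ε hε
    obtain ⟨p, hp⟩ := exists_polynomial_near_of_continuousOn (-M) M F hF.continuousOn (ε / 4)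
      (by positivity)
    have h := (ha.aeval p).tendsto
    rw [Metric.tendsto_nhds] at h
    filter_upwards [h (ε / 4) (by positivity)] with j hj
    rw [Real.dist_eq, sub_zero, abs_of_nonneg (D.defect_nonneg _ _ _)] at hj ⊢
    have h1 := D.defect_add_le (fun x => ((p.eval (g x) : ℝ) : ℂ))
      (fun x => ((F (g x) - p.eval (g x) : ℝ) : ℂ)) j (Polynomial.aeval (a j) p)
      (_root_.cfc F (a j) - Polynomial.aeval (a j) p)
    have h2 := D.defect_le (fun x => ((F (g x) - p.eval (g x) : ℝ) : ℂ)) j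
      (_root_.cfc F (a j) - Polynomial.aeval (a j) p) (M := ε / 4) (by positivity) fun x hx => by
        rw [Complex.norm_real, Real.norm_eq_abs, abs_sub_comm]
        exact (hp _ (hg' x hx)).le
    have h3 := norm_cfc_sub_aeval_le (hsa j) (hop' j) hF (by positivity : 0 ≤ ε / 4)
      fun t ht => (hp t ht).le
    simp only [Complex.ofReal_sub, add_sub_cancel] at h1 h2
    linarith

end JointResolution

end Representation

/-! ### Approximate joint diagonalization -/

section Existence

open scoped Matrix.Norms.L2Operator MatrixOrder

/-- A partition of unity of `[-R, R]` by squares of continuous functions with small supports. -/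
lemma exists_sq_partition {R r : ℝ} (hR : 0 < R) (hr : 0 < r) :
    ∃ (N : ℕ) (t : Fin N → ℝ) (φ : Fin N → ℝ → ℝ), (∀ k, Continuous (φ k)) ∧
      (∀ k, |t k| ≤ R) ∧ (∀ x ∈ Set.Icc (-R) R, ∑ k, φ k x ^ 2 = 1) ∧
      ∀ k x, φ k x ≠ 0 → |x - t k| ≤ r := by
  obtain ⟨N, hN⟩ := exists_nat_gt (2 * R / r)
  have hN0 : (0 : ℝ) < N := (by positivity : 0 < 2 * R / r).trans hN
  set h := 2 * R / N with hh
  have hh0 : 0 < h := by positivity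
  have hhr : h ≤ r := by
    rw [hh, div_le_iff₀ hN0]
    rw [div_lt_iff₀ hr] at hN
    linarith
  have hhN : h * N = 2 * R := by rw [hh]; field_simp
  set c : ℝ → ℝ := fun x => min (max x 0) 1 with hc
  have hcm : Monotone c := fun x y hxy => min_le_min_right _ (max_le_max_right _ hxy)
  have hcc : Continuous c := by fun_prop
  have hc0 : ∀ x ≤ 0, c x = 0 := fun x hx => by simp [hc, max_eq_right hx]
  have hc1 : ∀ x, 1 ≤ x → c x = 1 := fun x hx => by
    simp only [hc]
    exact min_eq_right (hx.trans (le_max_left _ _))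
  -- Tent functions on the grid of mesh `h`, written as differences of consecutive translates of a
  -- clamped ramp so that their sum telescopes. There are `N + 1` of them because both endpoints of
  -- `[-R, R]` are grid points.
  set ψ : ℕ → ℝ → ℝ := fun k x => c ((x + R) / h - k + 1) - c ((x + R) / h - k) with hψ
  have hψ0 : ∀ k x, 0 ≤ ψ k x := fun k x => sub_nonneg.2 (hcm (by linarith))
  refine ⟨N + 1, fun k => -R + k * h, fun k x => √(ψ k x), fun k => ?_, fun k => ?_,
    fun x hx => ?_, fun k x hk => ?_⟩
  · fun_prop
  · have hk : ((k : ℕ) : ℝ) ≤ N := by exact_mod_cast Nat.lt_succ_iff.1 k.2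
    have h1 : (k : ℝ) * h ≤ N * h := mul_le_mul_of_nonneg_right hk hh0.le
    have h2 : 0 ≤ (k : ℝ) * h := by positivity
    rw [abs_le]
    constructor <;> linarith
  · simp only [Real.sq_sqrt (hψ0 _ _)]
    rw [Fin.sum_univ_eq_sum_range (fun k => ψ k x) (N + 1)]
    have e : ∀ k ∈ Finset.range (N + 1), ψ k x =
        (fun i : ℕ => c ((x + R) / h - i + 1)) k - (fun i : ℕ => c ((x + R) / h - i + 1)) (k + 1) :=
      fun k _ => by
        simp only [hψ]
        push_cast
        ring_nf
    rw [Finset.sum_congr rfl e, Finset.sum_range_sub']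
    have h0 : 0 ≤ (x + R) / h := div_nonneg (by linarith [hx.1]) hh0.le
    have h1 : (x + R) / h ≤ N := by
      rw [div_le_iff₀ hh0, mul_comm, hhN]
      linarith [hx.2]
    rw [hc1 _ (by push_cast; linarith), hc0 _ (by push_cast; linarith), sub_zero]
  · by_contra hcon
    apply hk
    have hlt : h < |x - (-R + k * h)| := hhr.trans_lt (not_le.1 hcon)
    rw [Real.sqrt_eq_zero (hψ0 _ _)]
    have hx : x + R = (x + R) / h * h := by field_simp
    rcases lt_abs.1 hlt with h1 | h1
    · have : 1 ≤ (x + R) / h - k := by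
        rw [le_sub_iff_add_le, le_div_iff₀ hh0]
        linarith
      simp only [hψ]
      rw [hc1 _ (by linarith), hc1 _ this, sub_self]
    · have : (x + R) / h - k + 1 ≤ 0 := by
        have : (x + R) / h ≤ k - 1 := by
          rw [div_le_iff₀ hh0]
          linarith
        linarith
      simp only [hψ]
      rw [hc0 _ this, hc0 _ (by linarith), sub_self]

variable {ι : ℕ → Type} [∀ n, Fintype (ι n)] [∀ n, DecidableEq (ι n)] [∀ n, Nonempty (ι n)]

/-- Bounded, asymptotically commuting Hermitian matrices are approximately diagonalized by a
resolution of the identity with a fixed finite index set. -/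
theorem exists_approximate_resolution {R : ℝ} (hR : 0 < R) (q : ℕ) :
    ∀ (X : Fin q → ∀ n, Matrix (ι n) (ι n) ℂ), (∀ i n, IsSelfAdjoint (X i n)) →
      (∀ i n, ‖X i n‖ ≤ R) →
      (∀ i j, Tendsto (fun n => ‖X i n * X j n - X j n * X i n‖) atTop (𝓝 0)) →
      ∀ r > 0, ∃ (U : Type) (_ : Fintype U) (pt : U → Fin q → ℝ)
        (B : ∀ n, U → Matrix (ι n) (ι n) ℂ), (∀ u i, |pt u i| ≤ R) ∧
        (∀ n, ∑ u, star (B n u) * B n u = 1) ∧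
        ∀ i, ∀ᶠ n in atTop,
          colNorm (fun u => B n u * X i n - (pt u i : ℂ) • B n u) ≤ r := by
  induction q with
  | zero =>
    intro X _ _ _ r _
    exact ⟨Unit, inferInstance, fun _ => Fin.elim0, fun n _ => 1, fun _ i => i.elim0,
      fun n => by simp, fun i => i.elim0⟩
  | succ q ih =>
    intro X hsa hX hcomm r hr
    obtain ⟨U, hU, pt, B, hpt, hB, happ⟩ := ih (fun i => X i.succ) (fun i => hsa _) (fun i => hX _)
      (fun i j => hcomm _ _) (r / 2) (by positivity)
    obtain ⟨N, t, φ, hφ, ht, hsum, hsupp⟩ := exists_sq_partition hR hr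
    have hsp : ∀ n, ∀ x ∈ spectrum ℝ (X 0 n), x ∈ Set.Icc (-R) R := fun n x hx =>
      abs_le.1 (abs_le_of_mem_spectrum (hX 0 n) hx)
    have hcfcsa : ∀ (f : ℝ → ℝ) n, star (cfc f (X 0 n)) = cfc f (X 0 n) := fun f n =>
      (cfc_predicate f (X 0 n) : IsSelfAdjoint _)
    have hP : ∀ n, ∑ k, star (cfc (φ k) (X 0 n)) * cfc (φ k) (X 0 n) = 1 := fun n => by
      have hs := hsa 0 n
      simp only [hcfcsa]
      have e : ∀ k, cfc (φ k) (X 0 n) * cfc (φ k) (X 0 n) = cfc (fun x => φ k x ^ 2) (X 0 n) :=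
        fun k => by
          rw [← cfc_mul _ _ _ (hφ k).continuousOn (hφ k).continuousOn]
          simp only [sq]
      simp only [e]
      rw [← cfc_sum_univ (fun k x => φ k x ^ 2) (X 0 n) (fun k => by fun_prop)]
      rw [← cfc_one ℝ (X 0 n)]
      refine cfc_congr fun x hx => ?_
      simpa using hsum x (hsp n x hx)
    -- The resolution for the remaining matrices is refined by multiplying on the right by
    -- `φ_k(X_0)`. This factor then meets `X_0` directly, while every other matrix must be commuted
    -- past it.
    refine ⟨Fin N × U, inferInstance, fun p => Fin.cons (t p.1) (pt p.2),
      fun n p => B n p.2 * cfc (φ p.1) (X 0 n), fun p i => ?_, fun n => ?_, fun i => ?_⟩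
    · refine Fin.cases ?_ (fun i => ?_) i
      · exact ht _
      · exact hpt _ _
    · rw [Fintype.sum_prod_type]
      calc ∑ k, ∑ u, star (B n u * cfc (φ k) (X 0 n)) * (B n u * cfc (φ k) (X 0 n))
          = ∑ k, star (cfc (φ k) (X 0 n)) * (∑ u, star (B n u) * B n u) * cfc (φ k) (X 0 n) := by
            simp [Finset.mul_sum, Finset.sum_mul, mul_assoc]
        _ = 1 := by simp only [hB, mul_one, hP]
    · refine Fin.cases ?_ (fun i => ?_) i
      -- For `X_0` the estimate is exact in `n`: the isometric column `B` drops out, and `∑ φ_k(x)²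
      -- (x - t_k)² ≤ r²` on the spectrum.
      · refine Eventually.of_forall fun n => ?_
        have hs := hsa 0 n
        have e : (fun p : Fin N × U => B n p.2 * cfc (φ p.1) (X 0 n) * X 0 n -
            ((Fin.cons (t p.1) (pt p.2) : Fin (q + 1) → ℝ) 0 : ℂ) •
              (B n p.2 * cfc (φ p.1) (X 0 n))) =
            fun p => B n p.2 * (fun k => cfc (fun x => φ k x * (x - t k)) (X 0 n)) p.1 := by
          funext p
          have : cfc (fun x => φ p.1 x * (x - t p.1)) (X 0 n) =
              cfc (φ p.1) (X 0 n) * X 0 n - (t p.1 : ℂ) • cfc (φ p.1) (X 0 n) := by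
            have h1 : (fun x => φ p.1 x * (x - t p.1)) =
                fun x => φ p.1 x * x - t p.1 • φ p.1 x := by
              funext x
              rw [smul_eq_mul]
              ring
            rw [h1, cfc_sub (fun x => φ p.1 x * x) (fun x => t p.1 • φ p.1 x) _
              ((hφ _).mul continuous_id).continuousOn (((hφ p.1).const_smul (t p.1)).continuousOn :
                ContinuousOn (fun x => t p.1 • φ p.1 x) _),
              cfc_smul (t p.1) (φ p.1) _ (hφ _).continuousOn,
              cfc_mul (φ p.1) (fun x => x) _ (hφ _).continuousOn continuousOn_id,
              cfc_id' ℝ (X 0 n), Complex.coe_smul]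
          change _ = B n p.2 * cfc (fun x => φ p.1 x * (x - t p.1)) (X 0 n)
          rw [this, Fin.cons_zero, mul_sub, mul_smul_comm, mul_assoc]
        rw [e, colNorm_prod_eq (hB n) (fun k => cfc (fun x => φ k x * (x - t k)) (X 0 n))]
        refine le_of_sq_le_sq ?_ hr.le
        rw [colNorm_sq]
        simp only [hcfcsa]
        have e2 : ∀ k, cfc (fun x => φ k x * (x - t k)) (X 0 n) *
            cfc (fun x => φ k x * (x - t k)) (X 0 n) =
            cfc (fun x => φ k x ^ 2 * (x - t k) ^ 2) (X 0 n) := fun k => by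
          have hc : Continuous fun x => φ k x * (x - t k) := (hφ k).mul (by fun_prop)
          rw [← cfc_mul _ _ _ hc.continuousOn hc.continuousOn]
          congr 1
          funext x
          ring
        simp only [e2]
        rw [← cfc_sum_univ (fun k x => φ k x ^ 2 * (x - t k) ^ 2) (X 0 n) (fun k => by fun_prop)]
        refine norm_cfc_le (by positivity) fun x hx => ?_
        rw [Finset.sum_apply, Real.norm_eq_abs,
          abs_of_nonneg (Finset.sum_nonneg fun k _ => by positivity)]
        calc ∑ k, φ k x ^ 2 * (x - t k) ^ 2 ≤ ∑ k, φ k x ^ 2 * r ^ 2 := by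
              refine Finset.sum_le_sum fun k _ => ?_
              by_cases h0 : φ k x = 0
              · simp [h0]
              · refine mul_le_mul_of_nonneg_left ?_ (by positivity)
                rw [← sq_abs (x - t k)]
                exact pow_le_pow_left₀ (abs_nonneg _) (hsupp k x h0) 2
          _ = r ^ 2 := by rw [← Finset.sum_mul, hsum x (hsp n x hx), one_mul]
      · have hc : Tendsto (fun n => ∑ k, ‖cfc (φ k) (X 0 n) * X i.succ n -
            X i.succ n * cfc (φ k) (X 0 n)‖) atTop (𝓝 0) := by
          have := tendsto_finsetSum (Finset.univ : Finset (Fin N)) fun k _ =>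
            tendsto_norm_commutator_cfc (fun n => hsa 0 n) (hX 0) (hX i.succ) (hcomm 0 i.succ) (hφ k)
          simpa using this
        filter_upwards [happ i, hc.eventually (gt_mem_nhds (by positivity : 0 < r / 2))]
          with n h1 h2
        -- The old defect times `φ_k(X_0)`, which the partition of unity keeps below `r / 2`, plus
        -- commutators with `φ_k(X_0)`, which tend to zero for the fixed finite set of `k`.
        have e : (fun p : Fin N × U => B n p.2 * cfc (φ p.1) (X 0 n) * X i.succ n -
            ((Fin.cons (t p.1) (pt p.2) : Fin (q + 1) → ℝ) i.succ : ℂ) •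
              (B n p.2 * cfc (φ p.1) (X 0 n))) =
            fun p => (fun u => B n u * X i.succ n - (pt u i : ℂ) • B n u) p.2 *
                (fun k => cfc (φ k) (X 0 n)) p.1 +
              B n p.2 * (fun k => cfc (φ k) (X 0 n) * X i.succ n -
                X i.succ n * cfc (φ k) (X 0 n)) p.1 := by
          funext p
          simp only [Fin.cons_succ, sub_mul, mul_sub, smul_mul_assoc, mul_assoc]
          abel
        rw [e]
        refine (colNorm_add_le _ _).trans ?_
        have h3 := colNorm_prod_le (hP n) (fun u => B n u * X i.succ n - (pt u i : ℂ) • B n u)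
        have h4 := colNorm_prod_eq (hB n) (fun k => cfc (φ k) (X 0 n) * X i.succ n -
          X i.succ n * cfc (φ k) (X 0 n))
        have h5 := colNorm_le_sum (fun k => cfc (φ k) (X 0 n) * X i.succ n -
          X i.succ n * cfc (φ k) (X 0 n))
        linarith

/-- The filter of the pairs (mesh, size) for which the size is large, depending on the mesh. -/
def meshFilter : Filter (ℕ × ℕ) := (atTop : Filter ℕ).curry atTop

/-- The mesh is an auxiliary parameter: a conclusion about the size alone needs just one
sufficiently fine mesh. -/
lemma eventually_of_eventually_meshFilter {p : ℕ → Prop}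
    (h : ∀ᶠ j in meshFilter, p j.2) : ∀ᶠ n in atTop, p n := by
  have h' := Filter.eventually_curry_iff.1 h
  exact h'.exists.choose_spec

/-- Bounded, asymptotically commuting Hermitian matrices have an asymptotic joint
diagonalization with spectrum in a cube. -/
theorem exists_represents {q : ℕ} {R : ℝ} (hR : 0 < R) (X : Fin q → ∀ n, Matrix (ι n) (ι n) ℂ)
    (hsa : ∀ i n, IsSelfAdjoint (X i n)) (hX : ∀ i n, ‖X i n‖ ≤ R)
    (hcomm : ∀ i j, Tendsto (fun n => ‖X i n * X j n - X j n * X i n‖) atTop (𝓝 0)) :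
    ∃ D : JointResolution {x : Fin q → ℝ | ∀ i, |x i| ≤ R} (fun j : ℕ × ℕ => ι j.2),
      ∀ i, D.Represents meshFilter (fun x => ((x i : ℝ) : ℂ)) (fun j => X i j.2) := by
  choose U hU pt B hpt hB happ using fun N : ℕ =>
    exists_approximate_resolution hR q X hsa hX hcomm (1 / ((N : ℝ) + 1)) (by positivity)
  refine ⟨⟨fun j => U j.1, fun j => hU j.1, fun j => pt j.1, fun j => B j.1 j.2,
    fun j u i => hpt j.1 u i, fun j => hB j.1 j.2⟩, fun i => ⟨⟨R, hR.le, fun x hx => ?_⟩,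
    ⟨R, hR.le, fun j => hX i j.2⟩, ?_⟩⟩
  · rw [Complex.norm_real]
    exact hx i
  · rw [Metric.tendsto_nhds]
    intro ε hε
    refine Filter.eventually_curry_iff.2 ?_
    filter_upwards [tendsto_one_div_add_atTop_nhds_zero_nat.eventually (gt_mem_nhds hε)] with N hN
    filter_upwards [happ N i] with n hn
    rw [Real.dist_eq, sub_zero, abs_of_nonneg (JointResolution.defect_nonneg _ _ _ _)]
    exact hn.trans_lt hN

end Existence

/-! ### From bounds on functions to bounds on traces -/

section Positivity

open scoped ComplexOrder Matrix.Norms.L2Operator MatrixOrder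

variable {ι : Type} [Fintype ι] [DecidableEq ι]

lemma re_trace_mul_nonneg {E a : Matrix ι ι ℂ} (hE : 0 ≤ E) (ha : 0 ≤ a) :
    0 ≤ (E * a).trace.re := by
  obtain ⟨b, rfl⟩ := CStarAlgebra.nonneg_iff_eq_star_mul_self.1 ha
  rw [← mul_assoc, Matrix.trace_mul_comm, ← mul_assoc]
  have h : 0 ≤ b * E * star b := star_right_conjugate_nonneg hE b
  exact (Complex.nonneg_iff.1 (Matrix.nonneg_iff_posSemidef.1 h).trace_nonneg).1

lemma re_trace_mul_le {E a b : Matrix ι ι ℂ} (hE : 0 ≤ E) (hab : a ≤ b) :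
    (E * a).trace.re ≤ (E * b).trace.re := by
  have h := re_trace_mul_nonneg hE (sub_nonneg.2 hab)
  rw [mul_sub, Matrix.trace_sub, Complex.sub_re] at h
  linarith

lemma re_trace_mul_le_norm {E a : Matrix ι ι ℂ} (hE : 0 ≤ E) (ha : IsSelfAdjoint a) {c : ℝ}
    (hc : ‖a‖ ≤ c) : (E * a).trace.re ≤ c * E.trace.re := by
  have h1 : a ≤ algebraMap ℝ _ c := ha.le_algebraMap_norm_self.trans
    (algebraMap_mono (Matrix ι ι ℂ) hc)
  refine (re_trace_mul_le hE h1).trans (le_of_eq ?_)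
  rw [Algebra.algebraMap_eq_smul_one, mul_smul_comm, mul_one, Matrix.trace_smul]
  simp

/-- A Hermitian sequence that is represented by a nonnegative function is asymptotically
nonnegative. -/
theorem JointResolution.Represents.eventually_re_trace_ge {q : ℕ} {K : Set (Fin q → ℝ)} {J : Type}
    {l : Filter J} {ι : J → Type} [∀ j, Fintype (ι j)] [∀ j, DecidableEq (ι j)]
    {D : JointResolution K ι} {g : (Fin q → ℝ) → ℝ} {a : ∀ j, Matrix (ι j) (ι j) ℂ}
    (h : D.Represents l (fun x => (g x : ℂ)) a) (hsa : ∀ j, IsSelfAdjoint (a j)) {c : ℝ}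
    (hg : ∀ x ∈ K, c ≤ g x) {ε : ℝ} (hε : 0 < ε) :
    ∀ᶠ j in l, ∀ E : Matrix (ι j) (ι j) ℂ, 0 ≤ E →
      (c - ε) * E.trace.re ≤ (E * a j).trace.re := by
  obtain ⟨M, hM, hgM⟩ := h.bdd_fun
  -- Since `S - g` takes values in `[0, S - c]`, the norm of `S - a` is at most `S - c + ε`, which
  -- bounds `a` below by `c - ε`. The maximum with `c` matters only for empty `K`.
  set S := max M c with hS
  have hSM : M ≤ S := le_max_left _ _
  have hSc : c ≤ S := le_max_right _ _
  have hb := (JointResolution.Represents.const (D := D) (l := l) (S : ℂ)).sub h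
  filter_upwards [hb.tendsto.eventually (gt_mem_nhds hε)] with j hj E hE
  have h1 := D.norm_le_defect_add (fun x => (S : ℂ) - (g x : ℂ)) j ((S : ℂ) • 1 - a j)
    (M := S - c) (by linarith) fun x hx => by
      have h2 := hgM x hx
      rw [Complex.norm_real, Real.norm_eq_abs] at h2
      rw [← Complex.ofReal_sub, Complex.norm_real, Real.norm_eq_abs,
        abs_of_nonneg (by linarith [le_abs_self (g x)])]
      linarith [hg x hx]
  have hsa' : IsSelfAdjoint ((S : ℂ) • (1 : Matrix (ι j) (ι j) ℂ) - a j) := by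
    refine IsSelfAdjoint.sub ?_ (hsa j)
    rw [Complex.coe_smul]
    exact (IsSelfAdjoint.all S).smul (.one (Matrix (ι j) (ι j) ℂ))
  have h3 := re_trace_mul_le_norm hE hsa' (h1.trans (by linarith : _ ≤ S - c + ε))
  rw [mul_sub, mul_smul_comm, mul_one, Matrix.trace_sub, Matrix.trace_smul, Complex.sub_re,
    smul_eq_mul, Complex.re_ofReal_mul] at h3
  linarith

end Positivity

/-! ### Tensor products and mean-field averages -/

section Tensor

open scoped Matrix.Norms.L2Operator MatrixOrder

variable {m n : ℕ}

lemma tensor_mul (A B : Fin n → Matrix (Fin m) (Fin m) ℂ) :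
    tensor A * tensor B = tensor (fun k => A k * B k) := by
  ext σ τ
  simp only [tensor, Matrix.mul_apply, Matrix.of_apply, ← Finset.prod_mul_distrib]
  rw [Finset.prod_univ_sum, Fintype.piFinset_univ]

lemma tensor_one : tensor (fun _ : Fin n => (1 : Matrix (Fin m) (Fin m) ℂ)) = 1 := by
  ext σ τ
  simp only [tensor, Matrix.of_apply, Matrix.one_apply]
  by_cases h : σ = τ
  · simp [h]
  · rw [if_neg h]
    obtain ⟨k, hk⟩ := Function.ne_iff.1 h
    exact Finset.prod_eq_zero (Finset.mem_univ k) (if_neg hk)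

lemma star_tensor (A : Fin n → Matrix (Fin m) (Fin m) ℂ) :
    star (tensor A) = tensor (fun k => star (A k)) := by
  ext σ τ
  simp [tensor]

lemma trace_tensor (A : Fin n → Matrix (Fin m) (Fin m) ℂ) :
    (tensor A).trace = ∏ k, (A k).trace := by
  simp only [Matrix.trace, tensor, Matrix.diag_apply, Matrix.of_apply]
  rw [Finset.prod_univ_sum, Fintype.piFinset_univ]

lemma site_apply (X : Matrix (Fin m) (Fin m) ℂ) (k : Fin n) (σ τ : Fin n → Fin m) :
    site n X k σ τ =
      X (σ k) (τ k) * ∏ j ∈ Finset.univ.erase k, (1 : Matrix (Fin m) (Fin m) ℂ) (σ j) (τ j) := by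
  simp only [site, tensor, Matrix.of_apply]
  rw [← Finset.mul_prod_erase _ _ (Finset.mem_univ k), Function.update_self]
  congr 1
  refine Finset.prod_congr rfl fun j hj => ?_
  rw [Function.update_of_ne (Finset.ne_of_mem_erase hj)]

lemma site_one (k : Fin n) : site n (1 : Matrix (Fin m) (Fin m) ℂ) k = 1 := by
  rw [site, Function.update_eq_self_iff.2 rfl, tensor_one]

/-- The embedding of the one-site algebra at the site `k`. -/
def siteHom (k : Fin n) :
    Matrix (Fin m) (Fin m) ℂ →⋆ₐ[ℂ] Matrix (Fin n → Fin m) (Fin n → Fin m) ℂ where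
  toFun X := site n X k
  map_one' := site_one k
  map_mul' X Y := by
    rw [site, site, site, tensor_mul]
    congr 1
    funext j
    by_cases h : j = k
    · subst h
      simp
    · simp [Function.update_of_ne h]
  map_zero' := by
    ext σ τ
    simp [site_apply]
  map_add' X Y := by
    ext σ τ
    simp [site_apply, add_mul]
  commutes' c := by
    rw [Algebra.algebraMap_eq_smul_one, Algebra.algebraMap_eq_smul_one, ← site_one k]
    ext σ τ
    simp [site_apply, mul_assoc]
  map_star' X := by
    rw [site, site, star_tensor]
    congr 1
    funext j
    by_cases h : j = k
    · subst h
      simp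
    · simp [Function.update_of_ne h]

lemma siteHom_apply (k : Fin n) (X : Matrix (Fin m) (Fin m) ℂ) : siteHom k X = site n X k := rfl

lemma average_eq (n : ℕ) (X : Matrix (Fin m) (Fin m) ℂ) :
    average n X = (1 / (n : ℂ)) • ∑ k : Fin n, siteHom k X := rfl

lemma siteHom_mul_of_ne {k l : Fin n} (h : k ≠ l) (X Y : Matrix (Fin m) (Fin m) ℂ) :
    siteHom k X * siteHom l Y =
      tensor (Function.update (Function.update (fun _ => 1) k X) l Y) := by
  rw [siteHom_apply, siteHom_apply, site, site, tensor_mul]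
  congr 1
  funext j
  by_cases hl : j = l
  · subst hl
    simp [Function.update_of_ne h.symm]
  · simp [Function.update_of_ne hl]

lemma commute_siteHom {k l : Fin n} (h : k ≠ l) (X Y : Matrix (Fin m) (Fin m) ℂ) :
    Commute (siteHom k X) (siteHom l Y) := by
  rw [Commute, SemiconjBy, siteHom_mul_of_ne h, siteHom_mul_of_ne h.symm,
    Function.update_comm h]

lemma norm_siteHom_le (k : Fin n) (X : Matrix (Fin m) (Fin m) ℂ) : ‖siteHom k X‖ ≤ ‖X‖ :=
  NonUnitalStarAlgHom.norm_apply_le (siteHom k) X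

lemma norm_average_le (n : ℕ) (X : Matrix (Fin m) (Fin m) ℂ) : ‖average n X‖ ≤ ‖X‖ := by
  rw [average_eq, norm_smul]
  rcases Nat.eq_zero_or_pos n with rfl | hn
  · simp
  calc ‖(1 / (n : ℂ))‖ * ‖∑ k : Fin n, siteHom k X‖ ≤ ‖(1 / (n : ℂ))‖ * (n * ‖X‖) := by
        refine mul_le_mul_of_nonneg_left ((norm_sum_le _ _).trans ?_) (norm_nonneg _)
        refine (Finset.sum_le_sum fun k _ => norm_siteHom_le k X).trans (le_of_eq ?_)
        simp
    _ = ‖X‖ := by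
        have : (n : ℝ) ≠ 0 := by positivity
        simp only [one_div, norm_inv, Complex.norm_natCast]
        field_simp

lemma isSelfAdjoint_average (n : ℕ) {X : Matrix (Fin m) (Fin m) ℂ} (hX : IsSelfAdjoint X) :
    IsSelfAdjoint (average n X) := by
  rw [IsSelfAdjoint, average_eq, star_smul, star_sum]
  congr 1
  · simp
  · exact Finset.sum_congr rfl fun k _ => by rw [← map_star, hX]

lemma average_sub (n : ℕ) (X Y : Matrix (Fin m) (Fin m) ℂ) :
    average n (X - Y) = average n X - average n Y := by
  simp [average_eq, smul_sub]

lemma average_one {n : ℕ} (hn : n ≠ 0) : average n (1 : Matrix (Fin m) (Fin m) ℂ) = 1 := by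
  have : (n : ℂ) ≠ 0 := by exact_mod_cast hn
  simp [average_eq, ← Nat.cast_smul_eq_nsmul ℂ, smul_smul, this]

lemma average_smul (n : ℕ) (c : ℝ) (X : Matrix (Fin m) (Fin m) ℂ) :
    average n (c • X) = c • average n X := by
  have h : ∀ k : Fin n, siteHom k (c • X) = c • siteHom k X := fun k => by
    rw [← Complex.coe_smul, ← Complex.coe_smul, map_smul]
  simp only [average_eq, h]
  rw [← Finset.smul_sum, smul_comm]

lemma average_sum {q : ℕ} (n : ℕ) (X : Fin q → Matrix (Fin m) (Fin m) ℂ) :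
    average n (∑ i, X i) = ∑ i, average n (X i) := by
  simp only [average_eq, map_sum]
  rw [Finset.sum_comm, Finset.smul_sum]

/-- Operators at distinct sites commute, so only `n` of the `n²` terms survive. The resulting factor
`1 / n` is the source of asymptotic commutativity. -/
lemma average_commutator (n : ℕ) (X Y : Matrix (Fin m) (Fin m) ℂ) :
    average n X * average n Y - average n Y * average n X =
      (1 / (n : ℂ)) • average n (X * Y - Y * X) := by
  simp only [average_eq, smul_mul_smul_comm, ← smul_sub, smul_smul]
  congr 1
  simp only [Finset.sum_mul_sum]
  rw [Finset.sum_comm (f := fun i j : Fin n => siteHom i Y * siteHom j X), ← Finset.sum_sub_distrib]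
  refine Finset.sum_congr rfl fun k _ => ?_
  rw [← Finset.sum_sub_distrib, Finset.sum_eq_single k]
  · simp
  · intro l _ hl
    rw [(commute_siteHom hl.symm X Y).eq, sub_self]
  · simp

lemma tendsto_norm_commutator_average (X Y : Matrix (Fin m) (Fin m) ℂ) :
    Tendsto (fun n => ‖average n X * average n Y - average n Y * average n X‖) atTop (𝓝 0) := by
  refine squeeze_zero (fun n => norm_nonneg _) (fun n => ?_)
    (by simpa using tendsto_one_div_atTop_nhds_zero_nat.mul_const ‖X * Y - Y * X‖ :
      Tendsto (fun n : ℕ => 1 / (n : ℝ) * ‖X * Y - Y * X‖) atTop (𝓝 0))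
  rw [average_commutator, norm_smul]
  simp only [norm_div, norm_one, Complex.norm_natCast]
  exact mul_le_mul_of_nonneg_left (norm_average_le _ _) (by positivity)

lemma exp_siteHom (k : Fin n) (Z : Matrix (Fin m) (Fin m) ℂ) :
    NormedSpace.exp (siteHom k Z) = siteHom k (NormedSpace.exp Z) := by
  let : NormedAlgebra ℚ (Matrix (Fin m) (Fin m) ℂ) := .restrictScalars ℚ ℂ _
  exact (NormedSpace.map_exp (siteHom k)
    (LinearMap.continuous_of_finiteDimensional (siteHom k).toAlgHom.toLinearMap) Z).symm

/-- The one-site summands commute, so the exponential factorizes. Hence the Gibbs states of averages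
are product states with explicit moments. -/
lemma exp_smul_average {n : ℕ} (hn : n ≠ 0) (Z : Matrix (Fin m) (Fin m) ℂ) :
    NormedSpace.exp ((n : ℝ) • average n Z) = tensor fun _ : Fin n => NormedSpace.exp Z := by
  have h0 : (n : ℝ) • average n Z = ∑ k : Fin n, siteHom k Z := by
    have : (n : ℂ) ≠ 0 := by exact_mod_cast hn
    rw [average_eq, ← Complex.coe_smul, smul_smul]
    simp [this]
  have key : ∀ S : Finset (Fin n), NormedSpace.exp (∑ k ∈ S, siteHom k Z) =
      tensor fun k => if k ∈ S then NormedSpace.exp Z else 1 := fun S => by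
    induction S using Finset.induction_on with
    | empty => simp [NormedSpace.exp_zero, tensor_one]
    | insert k S hk ih =>
      rw [Finset.sum_insert hk, Matrix.exp_add_of_commute _ _
        (Commute.sum_right _ _ _ fun l hl => commute_siteHom (fun h : k = l => hk (h ▸ hl)) Z Z), ih,
        exp_siteHom, siteHom_apply, site, tensor_mul]
      congr 1
      funext j
      by_cases hj : j = k
      · subst hj
        simp [hk]
      · simp [hj]
  rw [h0, key]
  simp

end Tensor

/-! ### Evaluation of noncommutative polynomials -/

section Eval

lemma NCPoly.eval_eq_sum {q : ℕ} {A : Type*} [Ring A] [Algebra ℂ A] (Q : NCPoly q)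
    (a : Fin q → A) :
    Q.eval a = ∑ w ∈ Q.coeff.support, Q.coeff w • FreeMonoid.lift a w := by
  rw [NCPoly.eval, MonoidAlgebra.lift_apply, Finsupp.sum]

lemma star_freeMonoid_lift {q : ℕ} {A : Type*} [Ring A] [StarRing A] {a : Fin q → A}
    (ha : ∀ i, IsSelfAdjoint (a i)) (w : FreeMonoid (Fin q)) :
    star (FreeMonoid.lift a w) = FreeMonoid.lift a (star w) := by
  induction w using FreeMonoid.recOn with
  | one => simp
  | of_mul i w ih =>
    rw [map_mul, star_mul, star_mul, map_mul, ih, FreeMonoid.star_of, FreeMonoid.lift_eval_of,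
      (ha i).star_eq]

lemma NCPoly.IsSymmetric.isSelfAdjoint_eval {q : ℕ} {A : Type*} [Ring A] [StarRing A]
    [Algebra ℂ A] [StarModule ℂ A] {Q : NCPoly q} (hQ : Q.IsSymmetric) {a : Fin q → A}
    (ha : ∀ i, IsSelfAdjoint (a i)) : IsSelfAdjoint (Q.eval a) := by
  rw [IsSelfAdjoint, NCPoly.eval_eq_sum, star_sum]
  refine Finset.sum_bij' (fun w _ => star w) (fun w _ => star w) ?_ ?_ ?_ ?_ ?_
  · intro w hw
    rw [Finsupp.mem_support_iff] at hw ⊢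
    rw [hQ w]
    exact star_ne_zero.2 hw
  · intro w hw
    rw [Finsupp.mem_support_iff] at hw ⊢
    rw [hQ w]
    exact star_ne_zero.2 hw
  · simp
  · simp
  · intro w _
    rw [star_smul, star_freeMonoid_lift ha, hQ w]

lemma NCPoly.IsSymmetric.ofReal_realEval {q : ℕ} {Q : NCPoly q} (hQ : Q.IsSymmetric)
    (u : Fin q → ℝ) : (Q.realEval u : ℂ) = Q.eval (fun i => (u i : ℂ)) := by
  have h := hQ.isSelfAdjoint_eval (a := fun i => (u i : ℂ)) fun i => Complex.conj_ofReal _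
  exact Complex.conj_eq_iff_re.1 h

lemma NCPoly.continuous_realEval {q : ℕ} (Q : NCPoly q) : Continuous Q.realEval := by
  have h : ∀ w : FreeMonoid (Fin q),
      Continuous fun u : Fin q → ℝ => FreeMonoid.lift (fun i => (u i : ℂ)) w := fun w => by
    induction w using FreeMonoid.recOn with
    | one => simpa using continuous_const
    | of_mul i w ih =>
      simp only [map_mul, FreeMonoid.lift_eval_of]
      exact (Complex.continuous_ofReal.comp (continuous_apply i)).mul ih
  unfold NCPoly.realEval
  simp only [NCPoly.eval_eq_sum, smul_eq_mul]
  exact Complex.continuous_re.comp (continuous_finsetSum _ fun w _ => continuous_const.mul (h w))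

lemma JointResolution.Represents.eval {q : ℕ} {K : Set (Fin q → ℝ)} {J : Type}
    {l : Filter J} {ι : J → Type} [∀ j, Fintype (ι j)] [∀ j, DecidableEq (ι j)]
    {D : JointResolution K ι} {X : Fin q → ∀ j, Matrix (ι j) (ι j) ℂ}
    (h : ∀ i, D.Represents l (fun x => ((x i : ℝ) : ℂ)) (X i)) (Q : NCPoly q) :
    D.Represents l (fun x => Q.eval fun i => (x i : ℂ)) (fun j => Q.eval fun i => X i j) := by
  have hw : ∀ w : FreeMonoid (Fin q), D.Represents l
      (fun x => FreeMonoid.lift (fun i => (x i : ℂ)) w)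
      (fun j => FreeMonoid.lift (fun i => X i j) w) := fun w => by
    induction w using FreeMonoid.recOn with
    | one => simpa using Represents.const (D := D) (l := l) 1
    | of_mul i w ih =>
      simp only [map_mul, FreeMonoid.lift_eval_of]
      exact (h i).mul ih
  simp only [NCPoly.eval_eq_sum, smul_eq_mul]
  exact Represents.sum _ fun w _ => (hw w).smul _

end Eval

/-! ### Traces of exponentials -/

section Trace

open scoped ComplexOrder Matrix.Norms.L2Operator MatrixOrder

lemma ofReal_re_trace {ι : Type} [Fintype ι] {A : Matrix ι ι ℂ} (hA : IsSelfAdjoint A) :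
    ((A.trace.re : ℝ) : ℂ) = A.trace := by
  refine Complex.conj_eq_iff_re.1 ?_
  have h : star A.trace = A.trace := by
    rw [← Matrix.trace_conjTranspose, ← Matrix.star_eq_conjTranspose, hA.star_eq]
  exact h

variable {ι : Type} [Fintype ι] [DecidableEq ι]

/-- The trace in an eigenbasis of `H`, which separates the eigenvalues of `H` from an arbitrary `K`.
-/
lemma trace_cfc_mul {H : Matrix ι ι ℂ} (hH : H.IsHermitian) (f : ℝ → ℝ) (K : Matrix ι ι ℂ) :
    (cfc f H * K).trace = ∑ j, (f (hH.eigenvalues j) : ℂ) *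
      (star (hH.eigenvectorUnitary : Matrix ι ι ℂ) * K * hH.eigenvectorUnitary) j j := by
  rw [hH.cfc_eq, Matrix.IsHermitian.cfc, Unitary.conjStarAlgAut_apply, mul_assoc, mul_assoc,
    Matrix.trace_mul_comm, mul_assoc, Matrix.trace]
  refine Finset.sum_congr rfl fun j _ => ?_
  rw [Matrix.diag_apply, Matrix.diagonal_mul]
  rfl

lemma exp_smul_eq_cfc {A : Matrix ι ι ℂ} (hA : IsSelfAdjoint A) (r : ℝ) :
    NormedSpace.exp (r • A) = cfc (fun t => Real.exp (r * t)) A := by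
  rw [cfc_comp_const_mul r Real.exp A, CFC.real_exp_eq_normedSpace_exp]

lemma exp_eq_cfc {A : Matrix ι ι ℂ} (hA : IsSelfAdjoint A) :
    NormedSpace.exp A = cfc Real.exp A := (CFC.real_exp_eq_normedSpace_exp hA).symm

lemma exp_nonneg {A : Matrix ι ι ℂ} (hA : IsSelfAdjoint A) : 0 ≤ NormedSpace.exp A := by
  rw [exp_eq_cfc hA]
  exact cfc_nonneg fun t _ => (Real.exp_pos t).le

lemma re_trace_exp_pos [Nonempty ι] {A : Matrix ι ι ℂ} (hA : IsSelfAdjoint A) :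
    0 < (NormedSpace.exp A).trace.re := by
  have h := trace_cfc_mul (H := A) hA Real.exp 1
  rw [mul_one, mul_one, ← exp_eq_cfc hA] at h
  rw [h, Complex.re_sum]
  refine Finset.sum_pos (fun j _ => ?_) Finset.univ_nonempty
  have : star (Matrix.IsHermitian.eigenvectorUnitary (A := A) hA : Matrix ι ι ℂ) *
      (Matrix.IsHermitian.eigenvectorUnitary (A := A) hA : Matrix ι ι ℂ) = 1 :=
    Unitary.coe_star_mul_self _
  rw [this, Matrix.one_apply_eq, mul_one, Complex.ofReal_re]
  exact Real.exp_pos _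

/-- Klein's inequality for the exponential. -/
lemma klein_exp {H K : Matrix ι ι ℂ} (hH : IsSelfAdjoint H) (hK : IsSelfAdjoint K) :
    (NormedSpace.exp H * (1 + K - H)).trace.re ≤ (NormedSpace.exp K).trace.re := by
  have hH' : H.IsHermitian := hH
  set U : Matrix ι ι ℂ := (hH'.eigenvectorUnitary : Matrix ι ι ℂ)
  have hUU : star U * U = 1 := Unitary.coe_star_mul_self _
  have h1 : (NormedSpace.exp H * (1 + K - H)).trace = ∑ j,
      ((Real.exp (hH'.eigenvalues j) * (1 - hH'.eigenvalues j) : ℝ) : ℂ) * (star U * 1 * U : Matrix ι ι ℂ) j j +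
      ∑ j, (Real.exp (hH'.eigenvalues j) : ℂ) * (star U * K * U : Matrix ι ι ℂ) j j := by
    rw [← trace_cfc_mul hH' Real.exp, ← trace_cfc_mul hH' (fun t => Real.exp t * (1 - t)),
      cfc_mul Real.exp (fun t => 1 - t) H, cfc_sub (fun _ => 1) (fun t => t) H, cfc_id' ℝ H,
      cfc_const_one ℝ H, ← exp_eq_cfc hH, ← Matrix.trace_add, mul_one, ← mul_add]
    congr 2
    abel
  have h2 : (NormedSpace.exp K).trace = ∑ j, (star U * NormedSpace.exp K * U : Matrix ι ι ℂ) j j := by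
    have h3 := trace_cfc_mul hH' (fun _ => 1) (NormedSpace.exp K)
    rw [cfc_const_one ℝ H, one_mul] at h3
    simpa using h3
  rw [h1, h2, ← Finset.sum_add_distrib, Complex.re_sum, Complex.re_sum]
  refine Finset.sum_le_sum fun j _ => ?_
  set c := hH'.eigenvalues j
  -- The tangent line of `exp` at an eigenvalue `c` of `H`, applied to `K`. Only the diagonal entry
  -- at the corresponding eigenvector is used, so `H` and `K` need not commute.
  have hle : (Real.exp c * (1 - c)) • (1 : Matrix ι ι ℂ) + Real.exp c • K ≤ NormedSpace.exp K := by
    have e : (Real.exp c * (1 - c)) • (1 : Matrix ι ι ℂ) + Real.exp c • K =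
        cfc (fun t => Real.exp c * (1 - c) + Real.exp c * t) K := by
      rw [cfc_const_add (Real.exp c * (1 - c)) (fun t => Real.exp c * t) K,
        cfc_const_mul (Real.exp c) (fun t => t) K, cfc_id' ℝ K, Algebra.algebraMap_eq_smul_one]
    rw [e, exp_eq_cfc hK]
    refine cfc_mono fun t _ => ?_
    have h4 := Real.add_one_le_exp (t - c)
    have h5 : Real.exp t = Real.exp c * Real.exp (t - c) := by
      rw [← Real.exp_add]
      ring_nf
    rw [h5]
    nlinarith [Real.exp_pos c]
  have h6 := (Matrix.nonneg_iff_posSemidef.1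
    (star_left_conjugate_nonneg (sub_nonneg.2 hle) U)).diag_nonneg (i := j)
  have h7 := (Complex.nonneg_iff.1 h6).1
  rw [mul_sub, sub_mul, mul_add, add_mul, Matrix.sub_apply, Matrix.add_apply, mul_smul_comm,
    mul_smul_comm, smul_mul_assoc, smul_mul_assoc, Matrix.smul_apply, Matrix.smul_apply,
    Complex.sub_re, Complex.add_re, Complex.real_smul, Complex.real_smul] at h7
  rw [Complex.add_re]
  exact sub_nonneg.1 h7

/-- The Peierls–Bogoliubov inequality. -/
theorem peierls_bogoliubov [Nonempty ι] {H K : Matrix ι ι ℂ} (hH : IsSelfAdjoint H)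
    (hK : IsSelfAdjoint K) :
    logTraceExp H + (NormedSpace.exp H * (K - H)).trace.re / (NormedSpace.exp H).trace.re ≤
      logTraceExp K := by
  set Z := (NormedSpace.exp H).trace.re with hZ
  have hZ0 : 0 < Z := re_trace_exp_pos hH
  -- Subtracting the Gibbs mean of `K - H` makes the linear term of Klein's inequality vanish,
  -- leaving `Z ≤ e^{-c} Tr e^K`.
  set c := (NormedSpace.exp H * (K - H)).trace.re / Z with hc
  have hsa : IsSelfAdjoint (K - algebraMap ℝ _ c) := hK.sub (.algebraMap _ (.all c))
  have h := klein_exp hH hsa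
  have e1 : (NormedSpace.exp H * (1 + (K - algebraMap ℝ _ c) - H)).trace.re = Z := by
    have : NormedSpace.exp H * (1 + (K - algebraMap ℝ _ c) - H) =
        NormedSpace.exp H + NormedSpace.exp H * (K - H) - c • NormedSpace.exp H := by
      rw [Algebra.algebraMap_eq_smul_one]
      simp only [mul_add, mul_sub, mul_smul_comm, mul_one]
      abel
    rw [this, Matrix.trace_sub, Matrix.trace_add, Matrix.trace_smul, Complex.sub_re,
      Complex.add_re, Complex.smul_re, smul_eq_mul, ← hZ, hc]
    field_simp
    ring
  have e2 : NormedSpace.exp (K - algebraMap ℝ _ c) = Real.exp (-c) • NormedSpace.exp K := by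
    have : K - algebraMap ℝ (Matrix ι ι ℂ) c = cfc (fun t => t + -c) K := by
      rw [cfc_add_const (-c) (fun t => t) K, cfc_id' ℝ K, map_neg, sub_eq_add_neg]
    rw [exp_eq_cfc hsa, this, ← cfc_comp' Real.exp (fun t => t + -c) K, exp_eq_cfc hK,
      ← cfc_const_mul _ _ _]
    refine cfc_congr fun t _ => ?_
    rw [Real.exp_add, mul_comm]
  rw [e1, e2, Matrix.trace_smul, Complex.smul_re, smul_eq_mul] at h
  have hK0 := re_trace_exp_pos hK
  have h3 := Real.log_le_log hZ0 h
  rw [Real.log_mul (Real.exp_pos _).ne' hK0.ne', Real.log_exp] at h3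
  simp only [logTraceExp]
  linarith

end Trace

/-- The operator `F(Q(X^{(n)}))`. -/
def meanFieldOp {m q : ℕ} (X : Fin q → Matrix (Fin m) (Fin m) ℂ) (F : ℝ → ℝ) (Q : NCPoly q)
    (n : ℕ) : Matrix (Fin n → Fin m) (Fin n → Fin m) ℂ :=
  cfc F (Q.eval fun i => average n (X i))

/-! ### Gibbs states and moments of averages -/

section Gibbs

open scoped ComplexOrder Matrix.Norms.L2Operator MatrixOrder

section State

variable {ι : Type} [Fintype ι] [DecidableEq ι]

/-- The expectation `Tr (e^Z V) / Tr e^Z` in the Gibbs state of `Z`. -/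
def gibbs (Z : Matrix ι ι ℂ) : Matrix ι ι ℂ →ₗ[ℝ] ℝ where
  toFun V := (NormedSpace.exp Z * V).trace.re / (NormedSpace.exp Z).trace.re
  map_add' V W := by rw [mul_add, Matrix.trace_add, Complex.add_re, add_div]
  map_smul' c V := by
    rw [mul_smul_comm, Matrix.trace_smul, Complex.smul_re, smul_eq_mul, smul_eq_mul,
      mul_div_assoc, RingHom.id_apply]

lemma gibbs_apply (Z V : Matrix ι ι ℂ) :
    gibbs Z V = (NormedSpace.exp Z * V).trace.re / (NormedSpace.exp Z).trace.re := rfl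

lemma gibbs_one [Nonempty ι] {Z : Matrix ι ι ℂ} (hZ : IsSelfAdjoint Z) : gibbs Z 1 = 1 := by
  rw [gibbs_apply, mul_one, div_self (re_trace_exp_pos hZ).ne']

lemma logTraceExp_add_gibbs_le [Nonempty ι] {H K : Matrix ι ι ℂ} (hH : IsSelfAdjoint H)
    (hK : IsSelfAdjoint K) : logTraceExp H + gibbs H (K - H) ≤ logTraceExp K :=
  peierls_bogoliubov hH hK

end State

variable {m : ℕ}

lemma trace_exp_smul_average {n : ℕ} (hn : n ≠ 0) (Z : Matrix (Fin m) (Fin m) ℂ) :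
    (NormedSpace.exp ((n : ℝ) • average n Z)).trace = (NormedSpace.exp Z).trace ^ n := by
  rw [exp_smul_average hn, trace_tensor]
  simp

lemma re_trace_pow {Z : Matrix (Fin m) (Fin m) ℂ} (hZ : IsSelfAdjoint Z) (n : ℕ) :
    (NormedSpace.exp Z).trace ^ n = (((NormedSpace.exp Z).trace.re ^ n : ℝ) : ℂ) := by
  rw [Complex.ofReal_pow, ofReal_re_trace (IsSelfAdjoint.of_nonneg (exp_nonneg hZ))]

lemma logTraceExp_smul_average {n : ℕ} (hn : n ≠ 0) {Z : Matrix (Fin m) (Fin m) ℂ}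
    (hZ : IsSelfAdjoint Z) : logTraceExp ((n : ℝ) • average n Z) = n * logTraceExp Z := by
  rw [logTraceExp, trace_exp_smul_average hn, re_trace_pow hZ, Complex.ofReal_re, Real.log_pow,
    logTraceExp]

lemma trace_tensor_mul_siteHom {n : ℕ} (E V : Matrix (Fin m) (Fin m) ℂ) (k : Fin n) :
    (tensor (fun _ => E) * siteHom k V).trace = (E * V).trace * E.trace ^ (n - 1) := by
  rw [siteHom_apply, site, tensor_mul, trace_tensor,
    ← Finset.mul_prod_erase _ _ (Finset.mem_univ k), Function.update_self]
  congr 1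
  rw [Finset.prod_congr rfl (g := fun _ => E.trace) fun j hj => by
    rw [Function.update_of_ne (Finset.ne_of_mem_erase hj), mul_one]]
  simp

lemma trace_tensor_mul_siteHom_mul {n : ℕ} {E V : Matrix (Fin m) (Fin m) ℂ}
    (h : (E * V).trace = 0) {k l : Fin n} (hkl : k ≠ l) :
    (tensor (fun _ => E) * (siteHom k V * siteHom l V)).trace = 0 := by
  rw [siteHom_mul_of_ne hkl, tensor_mul, trace_tensor]
  refine Finset.prod_eq_zero (Finset.mem_univ k) ?_
  rw [Function.update_of_ne hkl, Function.update_self, h]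

lemma gibbs_average [Nonempty (Fin m)] {n : ℕ} (hn : n ≠ 0) {Z : Matrix (Fin m) (Fin m) ℂ}
    (hZ : IsSelfAdjoint Z) (V : Matrix (Fin m) (Fin m) ℂ) :
    gibbs ((n : ℝ) • average n Z) (average n V) = gibbs Z V := by
  have hz := re_trace_exp_pos hZ
  obtain ⟨k, rfl⟩ := Nat.exists_eq_succ_of_ne_zero hn
  rw [gibbs_apply, gibbs_apply, trace_exp_smul_average hn, re_trace_pow hZ, Complex.ofReal_re,
    exp_smul_average hn, average_eq, mul_smul_comm, Matrix.trace_smul, Finset.mul_sum,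
    Matrix.trace_sum]
  simp only [trace_tensor_mul_siteHom, re_trace_pow hZ]
  simp only [Finset.sum_const, Finset.card_univ, Fintype.card_fin, smul_eq_mul, nsmul_eq_mul]
  have hk : ((k.succ : ℕ) : ℂ) ≠ 0 := by exact_mod_cast hn
  rw [← mul_assoc, one_div, inv_mul_cancel₀ hk, one_mul, mul_comm, Complex.re_ofReal_mul,
    Nat.succ_sub_one, pow_succ]
  field_simp

/-- The law of large numbers: in a product state the terms at two distinct sites contain a factor
`Tr(e^Z V) = 0`, so `n` of the `n²` terms remain. -/
lemma gibbs_average_mul_self [Nonempty (Fin m)] {n : ℕ} (hn : n ≠ 0)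
    {Z V : Matrix (Fin m) (Fin m) ℂ} (hZ : IsSelfAdjoint Z) (hV : IsSelfAdjoint V)
    (h : gibbs Z V = 0) :
    gibbs ((n : ℝ) • average n Z) (average n V * average n V) = 1 / n * gibbs Z (V * V) := by
  have hz := re_trace_exp_pos hZ
  have hE : IsSelfAdjoint (NormedSpace.exp Z) := IsSelfAdjoint.of_nonneg (exp_nonneg hZ)
  have h0 : (NormedSpace.exp Z * V).trace = 0 := by
    rw [gibbs_apply, div_eq_zero_iff, or_iff_left hz.ne'] at h
    have h1 : star (NormedSpace.exp Z * V).trace = (NormedSpace.exp Z * V).trace := by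
      rw [← Matrix.trace_conjTranspose, ← Matrix.star_eq_conjTranspose, star_mul, hE.star_eq,
        hV.star_eq, Matrix.trace_mul_comm]
    rw [← Complex.conj_eq_iff_re.1 h1, h, Complex.ofReal_zero]
  have e : average n V * average n V =
      (1 / (n : ℂ) * (1 / (n : ℂ))) • ∑ k : Fin n, ∑ l : Fin n, siteHom k V * siteHom l V := by
    rw [average_eq, smul_mul_smul_comm, Finset.sum_mul_sum]
  obtain ⟨k, rfl⟩ := Nat.exists_eq_succ_of_ne_zero hn
  have hs : ∀ i : Fin k.succ, ∑ l : Fin k.succ,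
      (tensor (fun _ => NormedSpace.exp Z) * (siteHom i V * siteHom l V)).trace =
      (NormedSpace.exp Z * (V * V)).trace * (NormedSpace.exp Z).trace ^ k := fun i => by
    rw [Finset.sum_eq_single i]
    · rw [← map_mul, trace_tensor_mul_siteHom, Nat.succ_sub_one]
    · intro l _ hl
      exact trace_tensor_mul_siteHom_mul h0 hl.symm
    · simp
  rw [gibbs_apply, gibbs_apply, trace_exp_smul_average hn, re_trace_pow hZ, Complex.ofReal_re,
    exp_smul_average hn, e, mul_smul_comm, Matrix.trace_smul, Finset.mul_sum,
    Matrix.trace_sum]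
  simp only [Finset.mul_sum, Matrix.trace_sum, hs, re_trace_pow hZ]
  simp only [Finset.sum_const, Finset.card_univ, Fintype.card_fin, smul_eq_mul, nsmul_eq_mul]
  have hk : ((k.succ : ℕ) : ℂ) ≠ 0 := by exact_mod_cast hn
  have e3 : ∀ z w : ℂ, 1 / ((k.succ : ℕ) : ℂ) * (1 / ((k.succ : ℕ) : ℂ)) *
      (((k.succ : ℕ) : ℂ) * (z * w)) = ((1 / ((k.succ : ℕ) : ℝ) : ℝ) : ℂ) * (w * z) := fun z w => by
    push_cast at hk ⊢
    field_simp
  rw [e3, Complex.re_ofReal_mul, Complex.re_ofReal_mul, pow_succ]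
  field_simp

end Gibbs

/-! ### Tilted states and the lower bound -/

section Bounds

open scoped ComplexOrder Matrix.Norms.L2Operator MatrixOrder

variable {m q : ℕ} {X : Fin q → Matrix (Fin m) (Fin m) ℂ} {F : ℝ → ℝ} {Q : NCPoly q}

lemma isSelfAdjoint_tilt (hX : ∀ i, IsSelfAdjoint (X i)) (s : Fin q → ℝ) :
    IsSelfAdjoint (∑ i, s i • X i) :=
  isSelfAdjoint_sum _ fun i _ => (IsSelfAdjoint.all (s i)).smul (hX i)

lemma average_tilt (s : Fin q → ℝ) (n : ℕ) :
    average n (∑ i, s i • X i) = ∑ i, s i • average n (X i) := by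
  rw [average_sum]
  simp only [average_smul]

/-- The expectations of `X` in the tilted state. -/
def tiltedPoint (X : Fin q → Matrix (Fin m) (Fin m) ℂ) (s : Fin q → ℝ) : Fin q → ℝ :=
  fun i => gibbs (∑ i, s i • X i) (X i)

lemma gibbs_tilt (s t : Fin q → ℝ) :
    gibbs (∑ i, s i • X i) (∑ i, t i • X i) = ∑ i, t i * tiltedPoint X s i := by
  rw [map_sum]
  simp only [map_smul, smul_eq_mul]
  rfl

/-- Peierls–Bogoliubov at one site: the tilted point is a subgradient of `C` at `s`. Convexity is
thus obtained without differentiating a matrix exponential. -/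
lemma cumulant_add_le [Nonempty (Fin m)] (hX : ∀ i, IsSelfAdjoint (X i)) (s t : Fin q → ℝ) :
    cumulant X s + ∑ i, (t i - s i) * tiltedPoint X s i ≤ cumulant X t := by
  have h := logTraceExp_add_gibbs_le (isSelfAdjoint_tilt hX s) (isSelfAdjoint_tilt hX t)
  rw [map_sub, gibbs_tilt, gibbs_tilt] at h
  simp only [sub_mul, Finset.sum_sub_distrib]
  exact h

/-- A bound on the norms of the `X i`. -/
def radius (X : Fin q → Matrix (Fin m) (Fin m) ℂ) : ℝ := 1 + ∑ i, ‖X i‖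

lemma radius_pos (X : Fin q → Matrix (Fin m) (Fin m) ℂ) : 0 < radius X := by
  have : 0 ≤ ∑ i, ‖X i‖ := Finset.sum_nonneg fun i _ => norm_nonneg _
  rw [radius]
  linarith

lemma norm_le_radius (X : Fin q → Matrix (Fin m) (Fin m) ℂ) (i : Fin q) : ‖X i‖ ≤ radius X := by
  have := Finset.single_le_sum (f := fun i => ‖X i‖) (fun i _ => norm_nonneg _) (Finset.mem_univ i)
  rw [radius]
  linarith

/-- The cube that carries the asymptotic joint spectrum. -/
def cube (X : Fin q → Matrix (Fin m) (Fin m) ℂ) : Set (Fin q → ℝ) := {x | ∀ i, |x i| ≤ radius X}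

lemma isCompact_cube (X : Fin q → Matrix (Fin m) (Fin m) ℂ) : IsCompact (cube X) := by
  have : cube X = Set.univ.pi fun _ => Set.Icc (-radius X) (radius X) := by
    ext x
    simp only [cube, abs_le, Set.mem_ofPred_eq, Set.mem_univ_pi, Set.mem_Icc]
  rw [this]
  exact isCompact_univ_pi fun _ => isCompact_Icc

theorem exists_represents_average [Nonempty (Fin m)] (hX : ∀ i, IsSelfAdjoint (X i)) :
    ∃ D : JointResolution (cube X) (fun j : ℕ × ℕ => (Fin j.2 → Fin m)),
      ∀ i, D.Represents meshFilter (fun x => ((x i : ℝ) : ℂ)) (fun j => average j.2 (X i)) :=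
  exists_represents (ι := fun n => (Fin n → Fin m)) (radius_pos X) (fun i n => average n (X i))
    (fun i n => isSelfAdjoint_average n (hX i))
    (fun i n => (norm_average_le n (X i)).trans (norm_le_radius X i))
    (fun i j => tendsto_norm_commutator_average (X i) (X j))

lemma isSelfAdjoint_meanFieldOp (n : ℕ) : IsSelfAdjoint (meanFieldOp X F Q n) :=
  cfc_predicate F _

lemma JointResolution.Represents.meanFieldOp [Nonempty (Fin m)] (hX : ∀ i, IsSelfAdjoint (X i))
    (hF : Continuous F) (hQ : Q.IsSymmetric)
    {D : JointResolution (cube X) (fun j : ℕ × ℕ => (Fin j.2 → Fin m))}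
    (hD : ∀ i, D.Represents meshFilter (fun x => ((x i : ℝ) : ℂ)) (fun j => average j.2 (X i))) :
    D.Represents meshFilter (fun x => (F (Q.realEval x) : ℂ))
      (fun j => MeanField.meanFieldOp X F Q j.2) := by
  have h := Represents.eval hD Q
  simp only [← hQ.ofReal_realEval] at h
  exact h.cfc (fun j => hQ.isSelfAdjoint_eval fun i => isSelfAdjoint_average _ (hX i)) hF

/-- The lower bound by the tilted product states. -/
theorem eventually_le_logTraceExp [Nonempty (Fin m)] (hX : ∀ i, IsSelfAdjoint (X i))
    (hF : Continuous F) (hQ : Q.IsSymmetric) (s : Fin q → ℝ) {ε : ℝ} (hε : 0 < ε) :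
    ∀ᶠ n : ℕ in atTop,
      F (Q.realEval (tiltedPoint X s)) + cumulant X s - ∑ i, s i * tiltedPoint X s i - ε ≤
        1 / (n : ℝ) * logTraceExp ((n : ℝ) • meanFieldOp X F Q n) := by
  obtain ⟨D, hD⟩ := exists_represents_average hX
  set u := tiltedPoint X s with hu
  set f : (Fin q → ℝ) → ℝ := fun x => F (Q.realEval x) with hf
  have hfc : Continuous f := hF.comp Q.continuous_realEval
  have hA := JointResolution.Represents.meanFieldOp hX hF hQ hD
  -- A quadratic minorant of `f` on the cube. Near `u` continuity suffices; at distance at least `δ`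
  -- the quadratic term exceeds `|f u| + |M|`.
  obtain ⟨C, hC0, hC⟩ : ∃ C : ℝ, 0 ≤ C ∧ ∀ x ∈ cube X,
      f u - ε / 3 ≤ f x + C * ∑ i, (x i - u i) * (x i - u i) := by
    obtain ⟨M, hM⟩ := (isCompact_cube X).exists_bound_of_continuousOn hfc.continuousOn
    obtain ⟨δ, hδ, hδf⟩ := Metric.continuous_iff.1 hfc u (ε / 3) (by positivity)
    refine ⟨(|f u| + |M|) / δ ^ 2, by positivity, fun x hx => ?_⟩
    have hsq : 0 ≤ ∑ i, (x i - u i) * (x i - u i) :=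
      Finset.sum_nonneg fun i _ => mul_self_nonneg _
    by_cases hd : dist x u < δ
    · have h1 := abs_lt.1 (hδf x hd)
      have : 0 ≤ (|f u| + |M|) / δ ^ 2 * ∑ i, (x i - u i) * (x i - u i) := by positivity
      linarith [h1.1]
    · have h2 : ∃ i, δ ≤ dist (x i) (u i) := by
        by_contra hcon
        push Not at hcon
        exact hd ((dist_pi_lt_iff hδ).2 hcon)
      obtain ⟨i, hi⟩ := h2
      have h3 : δ ^ 2 ≤ ∑ i, (x i - u i) * (x i - u i) := by
        refine le_trans ?_ (Finset.single_le_sum (f := fun i => (x i - u i) * (x i - u i))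
          (fun i _ => mul_self_nonneg _) (Finset.mem_univ i))
        change δ ^ 2 ≤ (x i - u i) * (x i - u i)
        rw [← abs_mul_abs_self, ← sq]
        exact pow_le_pow_left₀ hδ.le hi 2
      have h4 : |f u| + |M| ≤ (|f u| + |M|) / δ ^ 2 * ∑ i, (x i - u i) * (x i - u i) := by
        rw [div_mul_eq_mul_div, le_div_iff₀ (by positivity)]
        exact mul_le_mul_of_nonneg_left h3 (by positivity)
      have h5 := hM x hx
      rw [Real.norm_eq_abs] at h5
      linarith [le_abs_self (f u), neg_abs_le (f x), le_abs_self M]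
  have hsub : ∀ i, D.Represents meshFilter (fun x => ((x i - u i : ℝ) : ℂ))
      (fun j => average j.2 (X i) - (u i : ℂ) • 1) := fun i => by
    simpa using (hD i).sub (JointResolution.Represents.const (u i : ℂ))
  have hT := hA.add ((JointResolution.Represents.sum Finset.univ
    fun i _ => (hsub i).mul (hsub i)).smul (C : ℂ))
  have e : (fun x : Fin q → ℝ => (F (Q.realEval x) : ℂ) +
      (C : ℂ) * ∑ i, ((x i - u i : ℝ) : ℂ) * ((x i - u i : ℝ) : ℂ)) =
      fun x => ((f x + C * ∑ i, (x i - u i) * (x i - u i) : ℝ) : ℂ) := by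
    funext x
    push_cast
    rfl
  rw [e] at hT
  have hsa1 : ∀ n i, IsSelfAdjoint (average n (X i) - (u i : ℂ) • 1) := fun n i => by
    rw [Complex.coe_smul]
    exact (isSelfAdjoint_average n (hX i)).sub ((IsSelfAdjoint.all (u i)).smul (.one _))
  have hpos := hT.eventually_re_trace_ge (fun j => by
    rw [Complex.coe_smul]
    refine (isSelfAdjoint_meanFieldOp j.2).add ((IsSelfAdjoint.all C).smul
      (isSelfAdjoint_sum _ fun i _ => ?_))
    rw [IsSelfAdjoint, star_mul, (hsa1 j.2 i).star_eq]) hC (by positivity : 0 < ε / 3)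
  have hpos' := eventually_of_eventually_meshFilter
    (p := fun n => ∀ E : Matrix (Fin n → Fin m) (Fin n → Fin m) ℂ, 0 ≤ E →
      (f u - ε / 3 - ε / 3) * E.trace.re ≤ (E * (meanFieldOp X F Q n + (C : ℂ) •
        ∑ i, (average n (X i) - (u i : ℂ) • 1) * (average n (X i) - (u i : ℂ) • 1))).trace.re) hpos
  set Z := ∑ i, s i • X i with hZ
  have hZsa : IsSelfAdjoint Z := isSelfAdjoint_tilt hX s
  -- Centring at the tilted point makes the mean of each `v i` vanish, so the quadratic term has
  -- expectation of order `1 / n`.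
  set v : Fin q → Matrix (Fin m) (Fin m) ℂ := fun i => X i - u i • 1 with hv
  have hvsa : ∀ i, IsSelfAdjoint (v i) := fun i =>
    (hX i).sub ((IsSelfAdjoint.all (u i)).smul (.one _))
  have hv0 : ∀ i, gibbs Z (v i) = 0 := fun i => by
    rw [hv, map_sub, map_smul, gibbs_one hZsa, smul_eq_mul, mul_one]
    exact sub_self _
  have hlim : Tendsto (fun n : ℕ => C * (1 / (n : ℝ) * ∑ i, gibbs Z (v i * v i))) atTop (𝓝 0) := by
    simpa using (tendsto_one_div_atTop_nhds_zero_nat.mul_const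
      (∑ i, gibbs Z (v i * v i))).const_mul C
  filter_upwards [hpos', hlim.eventually (gt_mem_nhds (by positivity : 0 < ε / 3)),
    eventually_ne_atTop 0] with n h1 h2 hn
  have hn0 : (0 : ℝ) < n := by positivity
  have hYsa : IsSelfAdjoint ((n : ℝ) • average n Z) :=
    (IsSelfAdjoint.all (n : ℝ)).smul (isSelfAdjoint_average n hZsa)
  have hAsa : IsSelfAdjoint ((n : ℝ) • meanFieldOp X F Q n) :=
    (IsSelfAdjoint.all (n : ℝ)).smul (isSelfAdjoint_meanFieldOp n)
  have h3 := h1 _ (exp_nonneg hYsa)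
  rw [← le_div_iff₀ (re_trace_exp_pos hYsa), ← gibbs_apply, map_add, Complex.coe_smul, map_smul,
    smul_eq_mul, map_sum] at h3
  have h4 : ∀ i, average n (X i) - (u i : ℂ) • 1 = average n (v i) := fun i => by
    rw [hv, average_sub, average_smul, average_one hn, Complex.coe_smul]
  simp only [h4, gibbs_average_mul_self hn hZsa (hvsa _) (hv0 _)] at h3
  rw [← Finset.mul_sum] at h3
  have h5 := logTraceExp_add_gibbs_le hYsa hAsa
  rw [logTraceExp_smul_average hn hZsa, map_sub, map_smul, map_smul, gibbs_average hn hZsa,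
    gibbs_tilt s s, smul_eq_mul, smul_eq_mul] at h5
  have h6 : cumulant X s = logTraceExp Z := rfl
  rw [one_div, ← div_eq_inv_mul, le_div_iff₀ hn0, h6]
  refine le_trans ?_ h5
  nlinarith

end Bounds

/-! ### The upper bound -/

section Upper

open scoped ComplexOrder Matrix.Norms.L2Operator MatrixOrder

variable {m q : ℕ} {X : Fin q → Matrix (Fin m) (Fin m) ℂ} {F : ℝ → ℝ} {Q : NCPoly q}

lemma JointResolution.Represents.tilt
    {D : JointResolution (cube X) (fun j : ℕ × ℕ => (Fin j.2 → Fin m))}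
    (hD : ∀ i, D.Represents meshFilter (fun x => ((x i : ℝ) : ℂ)) (fun j => average j.2 (X i)))
    (s : Fin q → ℝ) :
    D.Represents meshFilter (fun x => ((∑ i, s i * x i : ℝ) : ℂ))
      (fun j => average j.2 (∑ i, s i • X i)) := by
  have h := Represents.sum Finset.univ fun i _ => (hD i).smul (s i : ℂ)
  simp only [average_tilt]
  simpa [Complex.coe_smul] using h

/-- The contribution of a window around `(a, b)` to the trace of `e^{nA}`. -/
lemma re_trace_window_le [Nonempty (Fin m)] {n : ℕ} (hn : n ≠ 0)
    {A : Matrix (Fin n → Fin m) (Fin n → Fin m) ℂ} (hA : IsSelfAdjoint A)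
    {Z : Matrix (Fin m) (Fin m) ℂ} (hZ : IsSelfAdjoint Z) (a b : ℝ) {δ : ℝ} (hδ : 0 < δ) :
    (NormedSpace.exp ((n : ℝ) • A) *
      (cfc (fun t => max 0 (δ - |t - a|)) A *
        (cfc (fun t => max 0 (t - b + δ)) (average n Z) *
          cfc (fun t => max 0 (t - b + δ)) (average n Z)) *
        cfc (fun t => max 0 (δ - |t - a|)) A)).trace.re ≤
      2 * δ ^ 2 * Real.exp (n * (a + logTraceExp Z - b + 2 * δ)) := by
  have hn1 : (1 : ℝ) ≤ n := by exact_mod_cast Nat.one_le_iff_ne_zero.2 hn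
  set P := cfc (fun t => max 0 (δ - |t - a|)) A
  set Y := average n Z
  have hY : IsSelfAdjoint Y := isSelfAdjoint_average n hZ
  set T := cfc (fun t => max 0 (t - b + δ)) Y with hT
  have hTsa : IsSelfAdjoint T := cfc_predicate _ _
  have hTT : 0 ≤ T * T := by
    have := star_mul_self_nonneg T
    rwa [hTsa.star_eq] at this
  -- Cyclicity puts `e^{nA}` between the two cutoffs in `A`, so that `A` and `Y` are estimated
  -- separately although they do not commute.
  have e1 : (NormedSpace.exp ((n : ℝ) • A) * (P * (T * T) * P)).trace =
      (T * T * (P * NormedSpace.exp ((n : ℝ) • A) * P)).trace := by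
    rw [← mul_assoc, Matrix.trace_mul_comm, ← mul_assoc, ← mul_assoc,
      Matrix.trace_mul_comm (P * NormedSpace.exp ((n : ℝ) • A) * P), Matrix.trace_mul_comm]
  have h1 : P * NormedSpace.exp ((n : ℝ) • A) * P ≤
      algebraMap ℝ _ (δ ^ 2 * Real.exp (n * (a + δ))) := by
    rw [exp_smul_eq_cfc hA, ← cfc_mul _ _ A, ← cfc_mul _ _ A]
    refine cfc_le_algebraMap _ _ A (fun t _ => ?_)
    rcases le_or_gt δ |t - a| with h | h
    · rw [max_eq_left (by linarith)]
      simp only [zero_mul]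
      positivity
    · rw [max_eq_right (by linarith)]
      have h2 := abs_lt.1 h
      have h3 : Real.exp (n * t) ≤ Real.exp (n * (a + δ)) :=
        Real.exp_le_exp.2 (mul_le_mul_of_nonneg_left (by linarith) (by positivity))
      have h4 : 0 ≤ |t - a| := abs_nonneg _
      have h5 : (δ - |t - a|) ^ 2 ≤ δ ^ 2 := pow_le_pow_left₀ (by linarith) (by linarith) 2
      calc (δ - |t - a|) * Real.exp (n * t) * (δ - |t - a|)
          = (δ - |t - a|) ^ 2 * Real.exp (n * t) := by ring
        _ ≤ _ := mul_le_mul h5 h3 (Real.exp_pos _).le (by positivity)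
  -- The Chernoff estimate: for `y = t - b + δ > 0`, `y² ≤ 2 e^y ≤ 2 e^{ny}`, the last step by `n ≥
  -- 1`.
  have h2 : T * T ≤ (2 * Real.exp (n * (δ - b))) • NormedSpace.exp ((n : ℝ) • Y) := by
    rw [exp_smul_eq_cfc hY, hT, ← cfc_mul _ _ Y, ← cfc_const_mul _ _ Y]
    refine cfc_mono fun t _ => ?_
    rw [mul_assoc, ← Real.exp_add]
    rcases le_or_gt (t - b + δ) 0 with h | h
    · rw [max_eq_left h, zero_mul]
      positivity
    · rw [max_eq_right h.le]
      have h3 := Real.quadratic_le_exp_of_nonneg h.le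
      have h4 : Real.exp (t - b + δ) ≤ Real.exp (n * (δ - b) + n * t) := by
        refine Real.exp_le_exp.2 ?_
        nlinarith
      nlinarith
  have h3 : (T * T).trace.re ≤ 2 * Real.exp (n * (δ - b)) * Real.exp (n * logTraceExp Z) := by
    have h4 := re_trace_mul_le (Matrix.nonneg_iff_posSemidef.2 .one) h2
    rw [one_mul, one_mul, Matrix.trace_smul, Complex.smul_re, smul_eq_mul,
      trace_exp_smul_average hn, re_trace_pow hZ, Complex.ofReal_re] at h4
    rwa [logTraceExp, Real.exp_nat_mul (Real.log _), Real.exp_log (re_trace_exp_pos hZ)]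
  rw [e1]
  refine (re_trace_mul_le hTT h1).trans ?_
  rw [Algebra.algebraMap_eq_smul_one, mul_smul_comm, mul_one, Matrix.trace_smul, Complex.smul_re,
    smul_eq_mul]
  refine (mul_le_mul_of_nonneg_left h3 (by positivity)).trans (le_of_eq ?_)
  have e2 : n * (a + logTraceExp Z - b + 2 * δ) =
      n * (a + δ) + (n * (δ - b) + n * logTraceExp Z) := by ring
  rw [e2, Real.exp_add, Real.exp_add]
  ring

/-- The upper bound by localization in the asymptotic joint spectrum. -/
theorem eventually_logTraceExp_le [Nonempty (Fin m)] (hX : ∀ i, IsSelfAdjoint (X i))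
    (hF : Continuous F) (hQ : Q.IsSymmetric) {V : ℝ}
    (hV : ∀ x ∈ cube X, ∃ s, F (Q.realEval x) + cumulant X s - ∑ i, s i * x i ≤ V)
    {ε : ℝ} (hε : 0 < ε) :
    ∀ᶠ n : ℕ in atTop,
      1 / (n : ℝ) * logTraceExp ((n : ℝ) • meanFieldOp X F Q n) ≤ V + ε := by
  obtain ⟨D, hD⟩ := exists_represents_average hX
  set f : (Fin q → ℝ) → ℝ := fun x => F (Q.realEval x) with hf
  have hfc : Continuous f := hF.comp Q.continuous_realEval
  have hA := JointResolution.Represents.meanFieldOp hX hF hQ hD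
  set δ := ε / 4 with hδ
  have hδ0 : 0 < δ := by positivity
  have hV' : ∀ x, ∃ s, x ∈ cube X → f x + cumulant X s - ∑ i, s i * x i ≤ V := fun x => by
    by_cases hx : x ∈ cube X
    · obtain ⟨s, hs⟩ := hV x hx
      exact ⟨s, fun _ => hs⟩
    · exact ⟨0, fun h => absurd h hx⟩
  choose s hs using hV'
  -- The window at `x` localizes `f` two-sidedly, but bounds `⟨s_x, y⟩` only from below, which is
  -- all that the Chernoff estimate needs.
  set p : (Fin q → ℝ) → (Fin q → ℝ) → ℝ := fun x y => max 0 (δ - |f y - f x|) with hp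
  set θ : (Fin q → ℝ) → (Fin q → ℝ) → ℝ := fun x y =>
    max 0 (∑ i, s x i * y i - ∑ i, s x i * x i + δ) with hθ
  have hpc : ∀ x, Continuous (p x) := fun x => by fun_prop
  have hθc : ∀ x, Continuous (θ x) := fun x => by fun_prop
  have hp0 : ∀ x y, 0 ≤ p x y := fun x y => le_max_left _ _
  have hθ0 : ∀ x y, 0 ≤ θ x y := fun x y => le_max_left _ _
  set g : (Fin q → ℝ) → (Fin q → ℝ) → ℝ := fun x y => p x y * (θ x y * θ x y) * p x y with hg
  have hgc : ∀ x, Continuous (g x) := fun x => ((hpc x).mul ((hθc x).mul (hθc x))).mul (hpc x)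
  have hg0 : ∀ x y, 0 ≤ g x y := fun x y =>
    mul_nonneg (mul_nonneg (hp0 _ _) (mul_nonneg (hθ0 _ _) (hθ0 _ _))) (hp0 _ _)
  have hgx : ∀ x, 0 < g x x := fun x => by
    have h1 : p x x = δ := by simp [hp, hδ0.le]
    have h2 : θ x x = δ := by simp [hθ, hδ0.le]
    simp only [hg, h1, h2]
    positivity
  obtain ⟨T, hTK, hT⟩ := (isCompact_cube X).elim_nhds_subcover (fun x => {y | 0 < g x y})
    fun x _ => (isOpen_lt continuous_const (hgc x)).mem_nhds (hgx x)
  obtain ⟨c, hc0, hc⟩ := (isCompact_cube X).exists_forall_le' (f := fun y => ∑ x ∈ T, g x y)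
    (continuous_finsetSum _ fun x _ => hgc x).continuousOn (a := 0) fun y hy => by
      obtain ⟨x, hxT, hxy⟩ := Set.mem_iUnion₂.1 (hT hy)
      exact Finset.sum_pos' (fun x _ => hg0 x y) ⟨x, hxT, hxy⟩
  -- The cube contains the origin, so the cover is nonempty; this makes `M` below positive and its
  -- logarithm meaningful.
  have hTne : 0 < (T.card : ℝ) := by
    have h0 : (0 : Fin q → ℝ) ∈ cube X := fun i => by
      simpa using (radius_pos X).le
    obtain ⟨x, hxT, -⟩ := Set.mem_iUnion₂.1 (hT h0)
    exact_mod_cast Finset.card_pos.2 ⟨x, hxT⟩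
  set W : (Fin q → ℝ) → ∀ n : ℕ, Matrix (Fin n → Fin m) (Fin n → Fin m) ℂ := fun x n =>
    cfc (fun t => max 0 (δ - |t - f x|)) (meanFieldOp X F Q n) *
      (cfc (fun t => max 0 (t - ∑ i, s x i * x i + δ)) (average n (∑ i, s x i • X i)) *
        cfc (fun t => max 0 (t - ∑ i, s x i * x i + δ)) (average n (∑ i, s x i • X i))) *
      cfc (fun t => max 0 (δ - |t - f x|)) (meanFieldOp X F Q n) with hW
  have hWrep : ∀ x, D.Represents meshFilter (fun y => ((g x y : ℝ) : ℂ)) (fun j => W x j.2) :=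
    fun x => by
      have h1 := hA.cfc (fun j => isSelfAdjoint_meanFieldOp j.2)
        (F := fun t => max 0 (δ - |t - f x|)) (by fun_prop)
      have h2 := (JointResolution.Represents.tilt hD (s x)).cfc
        (fun j => isSelfAdjoint_average j.2 (isSelfAdjoint_tilt hX (s x)))
        (F := fun t => max 0 (t - ∑ i, s x i * x i + δ)) (by fun_prop)
      have h3 := (h1.mul (h2.mul h2)).mul h1
      simp only [← Complex.ofReal_mul] at h3
      exact h3
  have hWsa : ∀ x n, IsSelfAdjoint (W x n) := fun x n => by
    have h1 : ∀ (k : ℝ → ℝ) (a : Matrix (Fin n → Fin m) (Fin n → Fin m) ℂ),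
        star (cfc k a) = cfc k a := fun k a => (cfc_predicate k a : IsSelfAdjoint _)
    simp only [IsSelfAdjoint, hW, star_mul, h1, mul_assoc]
  have hS := JointResolution.Represents.sum T fun x _ => hWrep x
  simp only [← Complex.ofReal_sum] at hS
  have hpos := eventually_of_eventually_meshFilter
    (p := fun n => ∀ E : Matrix (Fin n → Fin m) (Fin n → Fin m) ℂ, 0 ≤ E →
      (c - c / 2) * E.trace.re ≤ (E * ∑ x ∈ T, W x n).trace.re)
    (hS.eventually_re_trace_ge (fun j => isSelfAdjoint_sum _ fun x _ => hWsa x j.2) hc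
      (by positivity : 0 < c / 2))
  -- The sum of the windows is at least `c / 2` under the trace, and each of the `T.card` windows
  -- contributes at most `2 δ² e^{n(V + 2δ)}`.
  set M := 4 * δ ^ 2 * T.card / c with hM
  have hM0 : 0 < M := by positivity
  have hlim : Tendsto (fun n : ℕ => 1 / (n : ℝ) * Real.log M) atTop (𝓝 0) := by
    simpa using tendsto_one_div_atTop_nhds_zero_nat.mul_const (Real.log M)
  filter_upwards [hpos, hlim.eventually (gt_mem_nhds (by positivity : 0 < ε / 2)),
    eventually_ne_atTop 0] with n h1 h2 hn
  have hn0 : (0 : ℝ) < n := by positivity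
  have hAsa : IsSelfAdjoint ((n : ℝ) • meanFieldOp X F Q n) :=
    (IsSelfAdjoint.all (n : ℝ)).smul (isSelfAdjoint_meanFieldOp n)
  have h3 := h1 _ (exp_nonneg hAsa)
  rw [Finset.mul_sum, Matrix.trace_sum, Complex.re_sum] at h3
  have h4 : ∀ x ∈ T, (NormedSpace.exp ((n : ℝ) • meanFieldOp X F Q n) * W x n).trace.re ≤
      2 * δ ^ 2 * Real.exp (n * (V + 2 * δ)) := fun x hx => by
    refine (re_trace_window_le hn (isSelfAdjoint_meanFieldOp n) (isSelfAdjoint_tilt hX (s x))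
      (f x) (∑ i, s x i * x i) hδ0).trans ?_
    refine mul_le_mul_of_nonneg_left (Real.exp_le_exp.2
      (mul_le_mul_of_nonneg_left ?_ hn0.le)) (by positivity)
    have h5 := hs x (hTK x hx)
    rw [cumulant] at h5
    linarith
  have h5 := h3.trans (Finset.sum_le_sum h4)
  rw [Finset.sum_const, nsmul_eq_mul] at h5
  have h6 : (NormedSpace.exp ((n : ℝ) • meanFieldOp X F Q n)).trace.re ≤
      M * Real.exp (n * (V + 2 * δ)) := by
    rw [hM, div_mul_eq_mul_div, le_div_iff₀ hc0]
    linarith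
  have h7 : logTraceExp ((n : ℝ) • meanFieldOp X F Q n) ≤ Real.log M + n * (V + 2 * δ) := by
    rw [logTraceExp]
    refine (Real.log_le_log (re_trace_exp_pos hAsa) h6).trans (le_of_eq ?_)
    rw [Real.log_mul hM0.ne' (Real.exp_pos _).ne', Real.log_exp]
  calc 1 / (n : ℝ) * logTraceExp ((n : ℝ) • meanFieldOp X F Q n)
      ≤ 1 / (n : ℝ) * (Real.log M + n * (V + 2 * δ)) :=
        mul_le_mul_of_nonneg_left h7 (by positivity)
    _ = 1 / (n : ℝ) * Real.log M + (V + 2 * δ) := by field_simp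
    _ ≤ V + ε := by rw [hδ]; linarith

end Upper

/-! ### Tilted points and Legendre duality -/

section Duality

open scoped ComplexOrder Matrix.Norms.L2Operator MatrixOrder

variable {m q : ℕ} {X : Fin q → Matrix (Fin m) (Fin m) ℂ}

lemma continuous_exp_tilt (X : Fin q → Matrix (Fin m) (Fin m) ℂ) :
    Continuous fun s : Fin q → ℝ => NormedSpace.exp (∑ i, s i • X i) := by
  let : NormedAlgebra ℚ (Matrix (Fin m) (Fin m) ℂ) := .restrictScalars ℚ ℂ _
  exact NormedSpace.exp_continuous.comp
    (continuous_finsetSum _ fun i _ => (continuous_apply i).smul continuous_const)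

lemma continuous_re_trace_exp_tilt (X : Fin q → Matrix (Fin m) (Fin m) ℂ)
    (V : Matrix (Fin m) (Fin m) ℂ) :
    Continuous fun s : Fin q → ℝ => (NormedSpace.exp (∑ i, s i • X i) * V).trace.re :=
  Complex.continuous_re.comp ((continuous_exp_tilt X).mul continuous_const).matrix_trace

lemma continuous_cumulant [Nonempty (Fin m)] (hX : ∀ i, IsSelfAdjoint (X i)) :
    Continuous (cumulant X) := by
  have h := continuous_re_trace_exp_tilt X 1
  simp only [mul_one] at h
  exact h.log fun s => (re_trace_exp_pos (isSelfAdjoint_tilt hX s)).ne'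

lemma continuous_tiltedPoint [Nonempty (Fin m)] (hX : ∀ i, IsSelfAdjoint (X i)) (i : Fin q) :
    Continuous fun s => tiltedPoint X s i := by
  have h := continuous_re_trace_exp_tilt X 1
  simp only [mul_one] at h
  exact (continuous_re_trace_exp_tilt X (X i)).div h
    fun s => (re_trace_exp_pos (isSelfAdjoint_tilt hX s)).ne'

/-- A first-order condition without derivatives: `h` is nonnegative to the right of zero and
nonpositive to the left. -/
lemma eq_zero_of_forall_mul_nonneg {h : ℝ → ℝ} (hc : Continuous h) (hh : ∀ t, 0 ≤ t * h t) :
    h 0 = 0 := by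
  refine le_antisymm ?_ ?_
  · refine le_of_tendsto (hc.continuousWithinAt (s := Set.Iio 0)) ?_
    filter_upwards [self_mem_nhdsWithin] with t ht
    exact nonpos_of_mul_nonneg_right (hh t) ht
  · refine ge_of_tendsto (hc.continuousWithinAt (s := Set.Ioi 0)) ?_
    filter_upwards [self_mem_nhdsWithin] with t ht
    exact nonneg_of_mul_nonneg_right (hh t) ht

/-- A point where the Legendre transform of the cumulant generating function is at most `r` is a
limit of tilted points where it is at most `r`. -/
theorem exists_tiltedPoint_near [Nonempty (Fin m)] (hX : ∀ i, IsSelfAdjoint (X i))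
    {u : Fin q → ℝ} {r : ℝ} (hr : ∀ s : Fin q → ℝ, ∑ i, s i * u i - cumulant X s ≤ r)
    {η : ℝ} (hη : 0 < η) :
    ∃ s, -r ≤ cumulant X s - ∑ i, s i * tiltedPoint X s i ∧ ∀ i, |tiltedPoint X s i - u i| ≤ η := by
  have hC0 : 0 ≤ cumulant X 0 + r := by
    have := hr 0
    simp only [Pi.zero_apply, zero_mul, Finset.sum_const_zero] at this
    linarith
  set b := cumulant X 0 + r + 1 with hb
  have hb0 : 0 < b := by linarith
  -- At the minimizer `(d / 2) |s|² ≤ b`, hence `|d s|² ≤ 2 d b = η²`, and `d s` is the displacement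
  -- of the tilted point from `u`.
  set d := η ^ 2 / (2 * b) with hd
  have hd0 : 0 < d := by positivity
  have hdb : 2 * d * b = η ^ 2 := by rw [hd]; field_simp
  -- The penalty makes the function coercive; without it the infimum need not be attained, for
  -- instance when `u` is extremal.
  set G : (Fin q → ℝ) → ℝ := fun s =>
    cumulant X s - ∑ i, s i * u i + d / 2 * ∑ i, s i * s i with hG
  have hGc : Continuous G := by
    have := continuous_cumulant hX
    fun_prop
  have hGl : ∀ s, -r + d / 2 * ∑ i, s i * s i ≤ G s := fun s => by
    have := hr s
    simp only [hG]
    linarith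
  have hG0 : G 0 = cumulant X 0 := by simp [hG]
  have hev : ∀ᶠ s in cocompact (Fin q → ℝ), G 0 ≤ G s := by
    filter_upwards [(tendsto_norm_cocompact_atTop (E := Fin q → ℝ)).eventually_ge_atTop
      √(2 * b / d)] with s hs
    refine le_trans ?_ (hGl s)
    have h1 : ‖s‖ ≤ √(∑ i, s i * s i) := by
      refine (pi_norm_le_iff_of_nonneg (Real.sqrt_nonneg _)).2 fun i => ?_
      rw [Real.norm_eq_abs, ← Real.sqrt_mul_self_eq_abs]
      exact Real.sqrt_le_sqrt (Finset.single_le_sum (f := fun i => s i * s i)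
        (fun i _ => mul_self_nonneg _) (Finset.mem_univ i))
    have h2 : 2 * b / d ≤ ∑ i, s i * s i :=
      (Real.sqrt_le_sqrt_iff (Finset.sum_nonneg fun i _ => mul_self_nonneg _)).1 (hs.trans h1)
    rw [div_le_iff₀ hd0] at h2
    rw [hG0]
    linarith
  obtain ⟨s, hs⟩ := hGc.exists_forall_le' 0 hev
  have hgrad : ∀ i, tiltedPoint X s i = u i - d * s i := fun i => by
    have hcont : Continuous fun t : ℝ =>
        tiltedPoint X (s + Pi.single i t) i - (u i - d * s i) + d / 2 * t := by
      have h1 : Continuous fun t : ℝ => s + Pi.single i t :=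
        continuous_const.add (continuous_single (A := fun _ : Fin q => ℝ) i)
      have h2 := (continuous_tiltedPoint hX i).comp h1
      exact (h2.sub continuous_const).add (continuous_const.mul continuous_id)
    -- Minimality at `s` is combined with the subgradient inequality based at the displaced point `s
    -- + t e_i`; the difference of cumulants cancels.
    have h0 := eq_zero_of_forall_mul_nonneg hcont fun t => by
      have h1 := hs (s + Pi.single i t)
      have h2 := cumulant_add_le hX (s + Pi.single i t) s
      have e : ∀ v : Fin q → ℝ, ∑ j, (Pi.single i t : Fin q → ℝ) j * v j = t * v i := fun v => by
        simp [Pi.single_apply, ite_mul]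
      have e1 : ∑ j, (s j - (s + (Pi.single i t : Fin q → ℝ)) j) * tiltedPoint X (s + (Pi.single i t : Fin q → ℝ)) j =
          -(t * tiltedPoint X (s + Pi.single i t) i) := by
        rw [← e, ← Finset.sum_neg_distrib]
        refine Finset.sum_congr rfl fun j _ => ?_
        rw [Pi.add_apply]
        ring
      have e2 : ∑ j, (s + (Pi.single i t : Fin q → ℝ)) j * u j = ∑ j, s j * u j + t * u i := by
        rw [← e, ← Finset.sum_add_distrib]
        refine Finset.sum_congr rfl fun j _ => ?_
        rw [Pi.add_apply]
        ring
      have e3 : ∑ j, (s + (Pi.single i t : Fin q → ℝ)) j * (s + (Pi.single i t : Fin q → ℝ)) j =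
          ∑ j, s j * s j + 2 * (t * s i) + t * t := by
        have e4 : t * t = ∑ j, (Pi.single i t : Fin q → ℝ) j * (Pi.single i t : Fin q → ℝ) j := by
          rw [e, Pi.single_eq_same]
        rw [e4, ← e s, Finset.mul_sum, ← Finset.sum_add_distrib, ← Finset.sum_add_distrib]
        refine Finset.sum_congr rfl fun j _ => ?_
        rw [Pi.add_apply]
        ring
      simp only [hG] at h1
      rw [e1] at h2
      rw [e2, e3] at h1
      nlinarith
    simp only [Pi.single_zero, add_zero, mul_zero] at h0
    linarith
  have hsq : d / 2 * ∑ i, s i * s i ≤ b := by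
    have h1 := hs 0
    have h2 := hGl s
    rw [hG0] at h1
    linarith
  refine ⟨s, ?_, fun i => ?_⟩
  -- Moving from `u` to the tilted point changes `⟨s, ·⟩` by `-d |s|²`, which has the favourable
  -- sign, so the bound `r` is kept without loss.
  · have e : ∑ i, s i * tiltedPoint X s i = ∑ i, s i * u i - d * ∑ i, s i * s i := by
      rw [Finset.mul_sum, ← Finset.sum_sub_distrib]
      refine Finset.sum_congr rfl fun i _ => ?_
      rw [hgrad]
      ring
    have h1 := hr s
    have h2 : 0 ≤ d * ∑ i, s i * s i :=
      mul_nonneg hd0.le (Finset.sum_nonneg fun i _ => mul_self_nonneg _)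
    rw [e]
    linarith
  · rw [hgrad i]
    refine abs_le_of_sq_le_sq ?_ hη.le
    have h1 : s i * s i ≤ ∑ i, s i * s i := Finset.single_le_sum (f := fun i => s i * s i)
      (fun i _ => mul_self_nonneg _) (Finset.mem_univ i)
    have h2 : d / 2 * (s i * s i) ≤ b := (mul_le_mul_of_nonneg_left h1 (by positivity)).trans hsq
    nlinarith

lemma gibbs_le [Nonempty (Fin m)] {Z V : Matrix (Fin m) (Fin m) ℂ} (hZ : IsSelfAdjoint Z)
    {c : ℝ} (h : V ≤ algebraMap ℝ _ c) : gibbs Z V ≤ c := by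
  have h1 : gibbs Z V ≤ gibbs Z (algebraMap ℝ _ c) :=
    div_le_div_of_nonneg_right (re_trace_mul_le (exp_nonneg hZ) h) (re_trace_exp_pos hZ).le
  rwa [Algebra.algebraMap_eq_smul_one, map_smul, gibbs_one hZ, smul_eq_mul, mul_one] at h1

lemma le_gibbs [Nonempty (Fin m)] {Z V : Matrix (Fin m) (Fin m) ℂ} (hZ : IsSelfAdjoint Z)
    {c : ℝ} (h : algebraMap ℝ _ c ≤ V) : c ≤ gibbs Z V := by
  have h1 : gibbs Z (algebraMap ℝ _ c) ≤ gibbs Z V :=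
    div_le_div_of_nonneg_right (re_trace_mul_le (exp_nonneg hZ) h) (re_trace_exp_pos hZ).le
  rwa [Algebra.algebraMap_eq_smul_one, map_smul, gibbs_one hZ, smul_eq_mul, mul_one] at h1

lemma tiltedPoint_mem_convexHull [Nonempty (Fin m)] (hX : ∀ i, IsSelfAdjoint (X i))
    (s : Fin q → ℝ) (i : Fin q) :
    tiltedPoint X s i ∈ convexHull ℝ (spectrum ℝ (X i)) := by
  have hfin : (spectrum ℝ (X i)).Finite := Matrix.finite_real_spectrum
  have hne : (spectrum ℝ (X i)).Nonempty :=
    ContinuousFunctionalCalculus.spectrum_nonempty (X i) (hX i)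
  obtain ⟨a, ha, hamin⟩ := Set.exists_min_image _ id hfin hne
  obtain ⟨b, hb, hbmax⟩ := Set.exists_max_image _ id hfin hne
  have hZ := isSelfAdjoint_tilt hX s
  have h1 : a ≤ tiltedPoint X s i :=
    le_gibbs hZ (algebraMap_le_of_le_spectrum (fun t ht => hamin t ht) (hX i))
  have h2 : tiltedPoint X s i ≤ b :=
    gibbs_le hZ (le_algebraMap_of_spectrum_le (fun t ht => hbmax t ht) (hX i))
  have h3 := segment_subset_convexHull (𝕜 := ℝ) ha hb
  rw [segment_eq_Icc (h1.trans h2)] at h3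
  exact h3 ⟨h1, h2⟩

end Duality

/-! ### The variational formula and the limit -/

section Limit

variable {m q : ℕ} {X : Fin q → Matrix (Fin m) (Fin m) ℂ}

/-- By the subgradient inequality, `s` itself maximizes the Legendre functional at its tilted point.
-/
lemma rate_tiltedPoint_le [Nonempty (Fin m)] (hX : ∀ i, IsSelfAdjoint (X i)) (s : Fin q → ℝ) :
    rate X (tiltedPoint X s) ≤ ((∑ i, s i * tiltedPoint X s i - cumulant X s : ℝ) : EReal) := by
  refine iSup_le fun t => EReal.coe_le_coe_iff.2 ?_
  have h := cumulant_add_le hX s t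
  simp only [sub_mul, Finset.sum_sub_distrib] at h
  linarith

/-- The variational problem restricted to the tilted product states. -/
def variational (X : Fin q → Matrix (Fin m) (Fin m) ℂ) (f : (Fin q → ℝ) → ℝ) (s : Fin q → ℝ) : ℝ :=
  f (tiltedPoint X s) + cumulant X s - ∑ i, s i * tiltedPoint X s i

lemma tiltedPoint_mem_cube [Nonempty (Fin m)] (hX : ∀ i, IsSelfAdjoint (X i)) (s : Fin q → ℝ) :
    tiltedPoint X s ∈ cube X := fun i => by
  open scoped Matrix.Norms.L2Operator in
  have h1 : spectrum ℝ (X i) ⊆ Set.Icc (-radius X) (radius X) := fun t ht =>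
    abs_le.1 (abs_le_of_mem_spectrum (norm_le_radius X i) ht)
  exact abs_le.2 (convexHull_min h1 (convex_Icc _ _) (tiltedPoint_mem_convexHull hX s i))

lemma bddAbove_variational [Nonempty (Fin m)] (hX : ∀ i, IsSelfAdjoint (X i))
    {f : (Fin q → ℝ) → ℝ} (hf : Continuous f) : BddAbove (Set.range (variational X f)) := by
  obtain ⟨M, hM⟩ := (isCompact_cube X).exists_bound_of_continuousOn hf.continuousOn
  refine ⟨M + cumulant X 0, ?_⟩
  rintro _ ⟨s, rfl⟩
  have h1 := (le_abs_self _).trans (hM _ (tiltedPoint_mem_cube hX s))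
  have h2 := cumulant_add_le hX s 0
  simp only [Pi.zero_apply, zero_sub, neg_mul, Finset.sum_neg_distrib] at h2
  rw [variational]
  linarith

/-- Points of finite rate need not be tilted points, but they are limits of tilted points without
loss in the entropy term; continuity of `f` does the rest. -/
lemma sub_le_iSup_variational [Nonempty (Fin m)] (hX : ∀ i, IsSelfAdjoint (X i))
    {f : (Fin q → ℝ) → ℝ} (hf : Continuous f) {u : Fin q → ℝ} {r : ℝ}
    (hr : ∀ s : Fin q → ℝ, ∑ i, s i * u i - cumulant X s ≤ r) :
    f u - r ≤ ⨆ s, variational X f s := by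
  refine le_of_forall_pos_le_add fun ε hε => ?_
  obtain ⟨η, hη, hηf⟩ := Metric.continuous_iff.1 hf u ε hε
  obtain ⟨s, hs, hsu⟩ := exists_tiltedPoint_near hX hr (half_pos hη)
  have h1 : dist (tiltedPoint X s) u < η :=
    ((dist_pi_le_iff (half_pos hη).le).2 fun i => hsu i).trans_lt (half_lt_self hη)
  have h2 := (abs_lt.1 (hηf _ h1)).1
  have h3 := le_ciSup (bddAbove_variational hX hf) s
  rw [variational] at h3
  linarith

/-- One inequality holds because tilted points lie in the product of the convex hulls; the other is
the approximation by tilted points and is trivial where the rate is infinite. -/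
lemma coe_iSup_variational [Nonempty (Fin m)] (hX : ∀ i, IsSelfAdjoint (X i))
    {f : (Fin q → ℝ) → ℝ} (hf : Continuous f) :
    ((⨆ s, variational X f s : ℝ) : EReal) =
      ⨆ u ∈ {u : Fin q → ℝ | ∀ i, u i ∈ convexHull ℝ (spectrum ℝ (X i))},
        ((f u : ℝ) : EReal) - rate X u := by
  refine le_antisymm ?_ (iSup₂_le fun u _ => ?_)
  · refine EReal.le_of_forall_lt_iff_le.1 fun z hz => ?_
    have h0 : ∀ s, variational X f s ≤ z := fun s => by
      refine EReal.coe_le_coe_iff.1 (le_trans ?_ hz.le)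
      refine le_trans ?_ (le_iSup₂_of_le (tiltedPoint X s)
        (fun i => tiltedPoint_mem_convexHull hX s i) le_rfl)
      refine le_trans (le_of_eq ?_) (EReal.sub_le_sub le_rfl (rate_tiltedPoint_le hX s))
      rw [← EReal.coe_sub, variational]
      congr 1
      ring
    exact EReal.coe_le_coe_iff.2 (ciSup_le h0)
  · have hbot : rate X u ≠ ⊥ := fun h => by
      have h1 := le_iSup (fun s : Fin q → ℝ =>
        ((∑ i, s i * u i - cumulant X s : ℝ) : EReal)) 0
      rw [← rate, h] at h1
      exact EReal.coe_ne_bot _ (le_bot_iff.1 h1)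
    by_cases htop : rate X u = ⊤
    · rw [htop, EReal.sub_top]
      exact bot_le
    · lift rate X u to ℝ using ⟨htop, hbot⟩ with r hr
      rw [← EReal.coe_sub, EReal.coe_le_coe_iff]
      refine sub_le_iSup_variational hX hf fun s => ?_
      rw [← EReal.coe_le_coe_iff, hr]
      exact le_iSup (fun s : Fin q → ℝ => ((∑ i, s i * u i - cumulant X s : ℝ) : EReal)) s

theorem tendsto_logTraceExp [Nonempty (Fin m)] (hX : ∀ i, IsSelfAdjoint (X i)) {F : ℝ → ℝ}
    (hF : Continuous F) {Q : NCPoly q} (hQ : Q.IsSymmetric) :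
    Tendsto (fun n : ℕ => 1 / (n : ℝ) * logTraceExp ((n : ℝ) • meanFieldOp X F Q n)) atTop
      (𝓝 (⨆ s, variational X (fun x => F (Q.realEval x)) s)) := by
  have hf : Continuous fun x => F (Q.realEval x) := hF.comp Q.continuous_realEval
  set L := ⨆ s, variational X (fun x => F (Q.realEval x)) s with hL
  rw [Metric.tendsto_nhds]
  intro ε hε
  obtain ⟨s, hs⟩ := exists_lt_of_lt_ciSup (show L - ε / 2 < L by linarith)
  -- The slack `ε / 4` is needed because the supremum defining the rate may not be attained. If no
  -- `s` worked at `x`, the rate there would be so small that `f - I` exceeds `L`.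
  have hup := eventually_logTraceExp_le hX hF hQ (V := L + ε / 4) (fun x _ => by
    by_contra hcon
    push Not at hcon
    have h := sub_le_iSup_variational hX hf (u := x) (r := F (Q.realEval x) - L - ε / 4)
      fun s => by linarith [hcon s]
    linarith) (by positivity : 0 < ε / 4)
  filter_upwards [eventually_le_logTraceExp hX hF hQ s (by positivity : 0 < ε / 4), hup]
    with n h1 h2
  rw [variational] at hs
  rw [Real.dist_eq, abs_lt]
  constructor <;> linarith

end Limit

end MeanField

end

theorem mainTheorem3 (m q : ℕ) (hm : 1 ≤ m) (X : Fin q → Matrix (Fin m) (Fin m) ℂ)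
    (hX : ∀ i, (X i).IsHermitian) (F : ℝ → ℝ) (hF : Continuous F)
    (Q : MeanField.NCPoly q) (hQ : Q.IsSymmetric) :
    ∃ L : ℝ,
      Tendsto
        (fun n : ℕ => (1 / (n : ℝ)) *
          MeanField.logTraceExp
            ((n : ℝ) • cfc F (Q.eval fun i => MeanField.average n (X i))))
        atTop (𝓝 L) ∧
      (L : EReal) =
        ⨆ u ∈ {u : Fin q → ℝ | ∀ i, u i ∈ convexHull ℝ (spectrum ℝ (X i))},
          ((F (Q.realEval u) : ℝ) : EReal) - MeanField.rate X u := by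
  have : Nonempty (Fin m) := ⟨⟨0, hm⟩⟩
  exact ⟨_, MeanField.tendsto_logTraceExp hX hF hQ,
    MeanField.coe_iSup_variational hX (hF.comp Q.continuous_realEval)⟩
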